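/- Let $\lambda\ge 0$ and let $W:\mathbb R\to\mathbb R$ be a pointy potential, i.e. $W$ is Lipschitz continuous, $W(-x)=W(x)$, $W(0)=0$, and $x\mapsto W(x)-\frac{\lambda}{2}x^2$ is concave. Let $W'$ be the derivative of $W$ on $\mathbb R\setminus\{0\}$; at the (at most countably many) points $x\ne 0$ where $W$ is not differentiable, $W'(x)$ is any fixed number between the right and the left derivative of $W$ at $x$, chosen so that $W'$ is odd. Let $\mathcal P_1(\mathbb R)$ be the set of Borel probability measures on $\mathbb R$ with finite first moment, and let $d_{W1}(\mu,\nu)=\inf_\gamma\iint|x-y|\,\gamma(dx,dy)$ be the Wasserstein distance of order one, the infimum being over all couplings $\gamma$ of $\mu$ and $\nu$. Let $0\le T\le\infty$, and for $i=1,2$ let $t\mapsto\rho_i(t)\in\mathcal P_1(\mathbb R)$ be defined for all $t\ge 0$ with $t\le T$ (so on $[0,\infty)$ if $T=\infty$), continuous for the weak topology $\sigma(\mathcal M_b,C_0)$ of the finite measures $\mathcal M_b(\mathbb R)$ in duality with $C_0(\mathbb R)$, with $\rho_i(0)=\rho_i^{ini}$, and such that $$\partial_t\rho_i+\partial_x\big(\widehat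 a_{\rho_i}\rho_i\big)=0\quad\text{in the sense of distributions on }(0,T)\times\mathbb R,\qquad \widehat a_{\rho}(t,x)=\int_{y\ne x}W'(x-y)\,\rho(t,dy).$$ Then for all $t\ge 0$ with $t\le T$, $$d_{W1}(\rho_1(t),\rho_2(t))\le e^{2\lambda t}\,d_{W1}(\rho_1^{ini},\rho_2^{ini}).$$ In particular the solution is unique: if $\rho_1^{ini}=\rho_2^{ini}$, then $\rho_1(t)=\rho_2(t)$ for all $t\ge 0$ with $t\le T$. -/

import Mathlib

open MeasureTheory Set
open scoped ENNReal NNReal ContDiff ZeroAtInfty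

noncomputable section

/-- `W` is an attractive pointy potential with concavity constant `lam ≥ 0`: it is Lipschitz
continuous, even, vanishes at `0`, and `W x - lam / 2 * x ^ 2` is concave. -/
structure IsPointyPotential (lam : ℝ) (W : ℝ → ℝ) : Prop where
  lipschitz : ∃ K : ℝ≥0, LipschitzWith K W
  even : ∀ x, W (-x) = W x
  zero : W 0 = 0
  lam_nonneg : 0 ≤ lam
  concave : ConcaveOn ℝ univ (fun x => W x - lam / 2 * x ^ 2)

/-- `W'` is an (everywhere defined) version of the derivative of the pointy potential `W` on
`ℝ \ {0}`: it is odd, and at every `x ≠ 0` its value lies between the right and the left derivative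
of `W` (these exist, in this order, because `W` is `lam`-concave). Wherever `W` is differentiable,
this says that `W' x` is the derivative of `W` at `x`; only at the (at most countably many) other
points is there a choice, which has to respect the oddness of the derivative. The value `W' 0` is
free; it is never used. -/
structure IsPointyDeriv (W W' : ℝ → ℝ) : Prop where
  odd : ∀ x, x ≠ 0 → W' (-x) = -W' x
  mem : ∀ x, x ≠ 0 → W' x ∈ Icc (derivWithin W (Ioi x) x) (derivWithin W (Iio x) x)

/-- At points of differentiability `W'` is the classical derivative. -/
theorem IsPointyDeriv.eq_deriv {W W' : ℝ → ℝ} (h : IsPointyDeriv W W') {x : ℝ} (hx : x ≠ 0)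
    (hd : DifferentiableAt ℝ W x) : W' x = deriv W x := by
  have h1 := h.mem x hx
  rw [hd.derivWithin (uniqueDiffWithinAt_Ioi x), hd.derivWithin (uniqueDiffWithinAt_Iio x)] at h1
  exact le_antisymm h1.2 h1.1

/-- The macroscopic velocity generated by the measure `μ`:
`x ↦ ∫_{y ≠ x} W' (x - y) μ(dy)`. -/
def macroVelocity (W' : ℝ → ℝ) (μ : Measure ℝ) (x : ℝ) : ℝ :=
  ∫ y in {x}ᶜ, W' (x - y) ∂μ

/-- Borel probability measures on the line with finite first moment. -/
def IsP1 (μ : Measure ℝ) : Prop :=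
  IsProbabilityMeasure μ ∧ Integrable (fun x : ℝ => |x|) μ

/-- The closed time interval `[0, T]`; it is `[0, ∞)` when `T = ∞`. -/
def closedTime (T : ℝ≥0∞) : Set ℝ := {t | 0 ≤ t ∧ ENNReal.ofReal t ≤ T}

/-- The open time interval `(0, T)`; it is `(0, ∞)` when `T = ∞`. -/
def openTime (T : ℝ≥0∞) : Set ℝ := {t | 0 < t ∧ ENNReal.ofReal t < T}

/-- `ρ` solves `∂ₜρ + ∂ₓ(b ρ) = 0` in the sense of distributions on `(0, T) × ℝ`. -/
def IsDistribSolution (T : ℝ≥0∞) (b : ℝ → ℝ → ℝ) (ρ : ℝ → Measure ℝ) : Prop :=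
  ∀ φ : ℝ × ℝ → ℝ, ContDiff ℝ ∞ φ → HasCompactSupport φ →
    tsupport φ ⊆ openTime T ×ˢ univ →
    ∫ t in openTime T, ∫ x, (deriv (fun s => φ (s, x)) t
      + b t x * deriv (fun y => φ (t, y)) x) ∂(ρ t) = 0

/-- `ρ` is a solution in the sense of distributions, with values in probability measures with finite
first moment, of `∂ₜρ + ∂ₓ(â_ρ ρ) = 0` on `(0, T) × ℝ` with initial datum `ρini`, where `â_ρ(t, ·)`
is the macroscopic velocity of `ρ t`. As usual for measure solutions, `ρ` is a continuous curve for
the weak topology of measures in duality with `C₀(ℝ)`. -/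
structure IsAggregationSolution (T : ℝ≥0∞) (W' : ℝ → ℝ) (ρini : Measure ℝ)
    (ρ : ℝ → Measure ℝ) : Prop where
  memP1 : ∀ t ∈ closedTime T, IsP1 (ρ t)
  continuous : ∀ f : C₀(ℝ, ℝ), ContinuousOn (fun t => ∫ x, f x ∂(ρ t)) (closedTime T)
  equation : IsDistribSolution T (fun t => macroVelocity W' (ρ t)) ρ
  initial : ρ 0 = ρini

/-- The Wasserstein distance of order one: the infimum of `∫∫ |x - y| dγ` over all couplings `γ` of
`μ` and `ν`. -/
def wasserstein1 (μ ν : Measure ℝ) : ℝ≥0∞ :=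
  ⨅ γ ∈ {γ : Measure (ℝ × ℝ) | γ.map Prod.fst = μ ∧ γ.map Prod.snd = ν},
    ∫⁻ p, edist p.1 p.2 ∂γ

end

/-! On the line, the order-one Wasserstein distance is the `L¹(0, 1)` distance between quantile
functions: the quantile coupling gives one bound, and the layer-cake formula `lintegral_edist_eq`
gives the other. So it suffices to follow the quantiles `X i t s` of the two solutions.

The velocity is bounded by some `K`. Testing the equation with steps travelling at speed `K` or `-K`
shows that mass moves no faster than `K` (`cdf_le_cdf_add`), so for every `s` the quantile is
`K`-Lipschitz in time. It then has a derivative `v` at almost every time, and the crucial point is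
that `v = b t (X t s)` almost everywhere (`ae_hasDerivAt_quantile`), although `b` may be
discontinuous in space. The continuity equation and the chain rule together give `∫ θ ψ'(X) (v -
b(X)) = 0`, hence `v - b(X)` has zero integral over every sublevel set of `X t`. Since `X t` is
monotone in `s`, particles at the same place share the same `v`, so `v - b(X)` is constant on the
flat pieces of `X t`; `ae_eq_zero_of_setIntegral_quantile_le` then makes it vanish.

With `Z = X 1 - X 2`, the derivative of `|Z|` is `sign Z` times the difference of velocities. The
velocities are interactions through the kernel `w` equal to `W'` off the origin and to `0` at it;
`w` is odd and `w x - lam * x` is nonincreasing. Symmetrising the double integral over pairs of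
particles replaces `sign Z s` by half of `sign Z s - sign Z s'`, and the one-sided condition bounds
the result by `2 * lam * ∫ |Z|` (`integral_sign_mul_interaction_le`). Grönwall's inequality
concludes. -/

open Filter Topology ProbabilityTheory

/-! ### Quantile functions and the Wasserstein distance on the line -/

/-- The uniform distribution on `(0, 1)`. -/
noncomputable abbrev unif : Measure ℝ := volume.restrict (Ioo (0 : ℝ) 1)

instance isProbabilityMeasure_unif : IsProbabilityMeasure unif := ⟨by simp [unif]⟩

/-- The quantile function of a measure on the line, extended by `0` outside `(0, 1)`. -/
noncomputable def quantile (μ : Measure ℝ) (s : ℝ) : ℝ :=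
  open Classical in if s ∈ Ioo (0 : ℝ) 1 then sInf {x | s ≤ cdf μ x} else 0

theorem quantile_of_mem (μ : Measure ℝ) {s : ℝ} (hs : s ∈ Ioo (0 : ℝ) 1) :
    quantile μ s = sInf {x | s ≤ cdf μ x} := if_pos hs

theorem quantile_of_notMem (μ : Measure ℝ) {s : ℝ} (hs : s ∉ Ioo (0 : ℝ) 1) :
    quantile μ s = 0 := if_neg hs

/-- Right-continuity of the cdf makes the infimum attained. On `(0, 1)`, everything below about
quantiles rests on this Galois connection. -/
theorem quantile_le_iff (μ : Measure ℝ) {s : ℝ} (hs : s ∈ Ioo (0 : ℝ) 1) (x : ℝ) :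
    quantile μ s ≤ x ↔ s ≤ cdf μ x := by
  have hbdd : BddBelow {x | s ≤ cdf μ x} := by
    obtain ⟨a, ha⟩ := ((tendsto_cdf_atBot μ).eventually (gt_mem_nhds hs.1)).exists
    refine ⟨a, fun y hy => le_of_not_gt fun hya => ?_⟩
    exact absurd (hy.trans (monotone_cdf μ hya.le)) (not_le.2 ha)
  have hne : {x | s ≤ cdf μ x}.Nonempty := by
    obtain ⟨a, ha⟩ := ((tendsto_cdf_atTop μ).eventually (lt_mem_nhds hs.2)).exists
    exact ⟨a, ha.le⟩
  rw [quantile_of_mem μ hs]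
  refine ⟨fun h => ?_, fun h => csInf_le hbdd h⟩
  rw [← (cdf μ).iInf_Ioi_eq x]
  refine le_ciInf fun y => ?_
  obtain ⟨a, ha, hay⟩ := exists_lt_of_csInf_lt hne (h.trans_lt y.2)
  exact ha.trans (monotone_cdf μ hay.le)

theorem quantile_mono (μ : Measure ℝ) {s s' : ℝ} (hs : s ∈ Ioo (0 : ℝ) 1)
    (hs' : s' ∈ Ioo (0 : ℝ) 1) (h : s ≤ s') : quantile μ s ≤ quantile μ s' :=
  (quantile_le_iff μ hs _).2 (h.trans ((quantile_le_iff μ hs' _).1 le_rfl))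

/-- By the Galois connection the sublevel sets are `{s ≤ cdf (r t) x}`, so measurability of each cdf
value in the parameter gives joint measurability. -/
theorem measurable_quantile_uncurry {α : Type*} [MeasurableSpace α] {r : α → Measure ℝ}
    (hr : ∀ x, Measurable fun t => cdf (r t) x) :
    Measurable fun p : α × ℝ => quantile (r p.1) p.2 := by
  refine measurable_of_Iic fun x => ?_
  have : (fun p : α × ℝ => quantile (r p.1) p.2) ⁻¹' Iic x =
      ({p | p.2 ∈ Ioo (0 : ℝ) 1} ∩ {p | p.2 ≤ cdf (r p.1) x}) ∪
        ({p | p.2 ∉ Ioo (0 : ℝ) 1} ∩ {_p | (0 : ℝ) ≤ x}) := by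
    ext p
    by_cases hp : p.2 ∈ Ioo (0 : ℝ) 1
    · simp only [mem_preimage, mem_Iic, mem_union, mem_inter_iff, mem_ofPred_eq, hp,
        quantile_le_iff _ hp, true_and, not_true, false_and, or_false]
    · simp only [mem_preimage, mem_Iic, mem_union, mem_inter_iff, mem_ofPred_eq, hp,
        quantile_of_notMem _ hp, true_and, not_false_eq_true, false_and, false_or]
  rw [this]
  have h1 : MeasurableSet {p : α × ℝ | p.2 ∈ Ioo (0 : ℝ) 1} := measurable_snd measurableSet_Ioo
  exact (h1.inter (measurableSet_le measurable_snd ((hr x).comp measurable_fst))).union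
    (h1.compl.inter (MeasurableSet.const _))

theorem measurable_quantile (μ : Measure ℝ) : Measurable (quantile μ) :=
  (measurable_quantile_uncurry (α := Unit) (r := fun _ => μ) fun _ => measurable_const).comp
    (measurable_const (a := ()) |>.prodMk measurable_id)

/-- The sets can differ only at `s = 1`, which lies in the right-hand side when the cdf reaches `1`.
-/
theorem quantile_le_ae_eq (μ : Measure ℝ) (x : ℝ) :
    ({s | quantile μ s ≤ x} ∩ Ioo 0 1 : Set ℝ) =ᵐ[volume] Ioc 0 (cdf μ x) := by
  have h1 : ∀ᵐ s : ℝ, s ≠ 1 := by simp [ae_iff]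
  filter_upwards [h1] with s hs
  refine eq_iff_iff.2 ⟨fun h => ⟨h.2.1, (quantile_le_iff μ h.2 x).1 h.1⟩, fun h => ?_⟩
  have h2 : s ∈ Ioo (0 : ℝ) 1 := ⟨h.1, lt_of_le_of_ne (h.2.trans (cdf_le_one μ x)) hs⟩
  exact ⟨(quantile_le_iff μ h2 x).2 h.2, h2⟩

theorem measurableSet_quantile_le (μ : Measure ℝ) (x : ℝ) : MeasurableSet {s | quantile μ s ≤ x} :=
  measurableSet_le (measurable_quantile μ) measurable_const

theorem unif_quantile_le (μ : Measure ℝ) (x : ℝ) :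
    unif {s | quantile μ s ≤ x} = ENNReal.ofReal (cdf μ x) := by
  rw [Measure.restrict_apply (measurableSet_quantile_le μ x),
    measure_congr (quantile_le_ae_eq μ x), Real.volume_Ioc, sub_zero]

/-- The quantile function transports the uniform distribution to the measure. -/
theorem map_quantile (μ : Measure ℝ) [IsProbabilityMeasure μ] : unif.map (quantile μ) = μ := by
  have : IsProbabilityMeasure (unif.map (quantile μ)) :=
    Measure.isProbabilityMeasure_map (measurable_quantile μ).aemeasurable
  refine Measure.ext_of_Iic _ _ fun x => ?_
  rw [Measure.map_apply (measurable_quantile μ) measurableSet_Iic]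
  exact (unif_quantile_le μ x).trans (ofReal_cdf μ x)

theorem integral_quantile (μ : Measure ℝ) [IsProbabilityMeasure μ] {g : ℝ → ℝ}
    (hg : Measurable g) : ∫ x, g x ∂μ = ∫ s, g (quantile μ s) ∂unif := by
  conv_lhs => rw [← map_quantile μ]
  exact integral_map (measurable_quantile μ).aemeasurable hg.aestronglyMeasurable

theorem integrable_quantile {μ : Measure ℝ} (hμ : IsP1 μ) : Integrable (quantile μ) unif := by
  have := hμ.1
  have h := hμ.2
  rw [← map_quantile μ] at h
  have h2 := (integrable_map_measure (by fun_prop) (measurable_quantile μ).aemeasurable).1 h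
  exact (integrable_norm_iff (measurable_quantile μ).aestronglyMeasurable).1 h2

theorem wasserstein1_le_lintegral_quantile (μ ν : Measure ℝ) [IsProbabilityMeasure μ]
    [IsProbabilityMeasure ν] :
    wasserstein1 μ ν ≤ ∫⁻ s, edist (quantile μ s) (quantile ν s) ∂unif := by
  have hm : Measurable fun s => (quantile μ s, quantile ν s) :=
    (measurable_quantile μ).prodMk (measurable_quantile ν)
  refine (iInf₂_le (unif.map fun s => (quantile μ s, quantile ν s)) ⟨?_, ?_⟩).trans_eq
    (lintegral_map (by fun_prop) hm)
  · rw [Measure.map_map measurable_fst hm]; exact map_quantile μ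
  · rw [Measure.map_map measurable_snd hm]; exact map_quantile ν

theorem edist_eq_volume_symmDiff_Ici (x y : ℝ) :
    edist x y = volume (symmDiff (Ici x) (Ici y)) := by
  wlog hxy : x ≤ y generalizing x y
  · rw [edist_comm, symmDiff_comm, this y x (le_of_not_ge hxy)]
  have : symmDiff (Ici x) (Ici y) = Ico x y := by
    ext z
    simp only [mem_symmDiff, mem_Ici, mem_Ico]
    constructor
    · rintro (h | h)
      · exact ⟨h.1, not_le.1 h.2⟩
      · exact absurd (hxy.trans h.1) h.2
    · exact fun h => Or.inl ⟨h.1, not_le.2 h.2⟩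
  rw [this, Real.volume_Ico, edist_comm, edist_dist, Real.dist_eq, abs_of_nonneg (by linarith)]

/-- The layer-cake formula for transport costs on the line. -/
theorem lintegral_edist_eq {α : Type*} [MeasurableSpace α] (γ : Measure α) [SFinite γ]
    {f g : α → ℝ} (hf : Measurable f) (hg : Measurable g) :
    ∫⁻ p, edist (f p) (g p) ∂γ
      = ∫⁻ z, γ (symmDiff {p | f p ≤ z} {p | g p ≤ z}) := by
  have hS : MeasurableSet {q : α × ℝ | q ∈ symmDiff {q : α × ℝ | f q.1 ≤ q.2}
      {q : α × ℝ | g q.1 ≤ q.2}} :=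
    (measurableSet_le (hf.comp measurable_fst) measurable_snd).symmDiff
      (measurableSet_le (hg.comp measurable_fst) measurable_snd)
  have h1 := Measure.prod_apply (μ := γ) (ν := (volume : Measure ℝ)) hS
  have h2 := Measure.prod_apply_symm (μ := γ) (ν := (volume : Measure ℝ)) hS
  rw [h1] at h2
  refine Eq.trans (lintegral_congr fun p => ?_) h2
  exact edist_eq_volume_symmDiff_Ici _ _

/-- In the layer-cake formula, any coupling gives the symmetric difference at level `z` at least the
mass `|cdf μ z - cdf ν z|`, while for the quantile coupling this mass is an upper bound. The
comparison is thus made level by level. -/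
theorem lintegral_quantile_le_wasserstein1 (μ ν : Measure ℝ) [IsProbabilityMeasure μ]
    [IsProbabilityMeasure ν] :
    ∫⁻ s, edist (quantile μ s) (quantile ν s) ∂unif ≤ wasserstein1 μ ν := by
  refine le_iInf₂ fun γ hγ => ?_
  have hp : IsProbabilityMeasure γ := by
    have : IsProbabilityMeasure (γ.map Prod.fst) := by rw [hγ.1]; infer_instance
    exact Measure.isProbabilityMeasure_of_map (f := Prod.fst)
  rw [lintegral_edist_eq unif (measurable_quantile μ) (measurable_quantile ν),
    lintegral_edist_eq γ measurable_fst measurable_snd]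
  refine lintegral_mono fun z => ?_
  have h1 : cdf μ z = γ.real {p | p.1 ≤ z} := by
    rw [cdf_eq_real, ← hγ.1, map_measureReal_apply measurable_fst measurableSet_Iic]; rfl
  have h2 : cdf ν z = γ.real {p | p.2 ≤ z} := by
    rw [cdf_eq_real, ← hγ.2, map_measureReal_apply measurable_snd measurableSet_Iic]; rfl
  have h3 : unif (symmDiff {s | quantile μ s ≤ z} {s | quantile ν s ≤ z})
      ≤ ENNReal.ofReal |cdf μ z - cdf ν z| := by
    rw [Measure.restrict_apply ((measurableSet_quantile_le μ z).symmDiff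
      (measurableSet_quantile_le ν z))]
    refine (measure_mono (t := uIoc (cdf μ z) (cdf ν z)) ?_).trans ?_
    · rintro s ⟨hs, hs1⟩
      simp only [mem_symmDiff, mem_ofPred_eq, quantile_le_iff _ hs1] at hs
      rw [mem_uIoc]
      rcases hs with hs | hs
      · exact Or.inr ⟨not_le.1 hs.2, hs.1⟩
      · exact Or.inl ⟨not_le.1 hs.2, hs.1⟩
    · rw [Real.volume_uIoc, abs_sub_comm]
  refine h3.trans ?_
  rw [h1, h2]
  refine ENNReal.ofReal_le_of_le_toReal ?_
  exact abs_measureReal_sub_le_measureReal_symmDiff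
    (measurableSet_le measurable_fst measurable_const).nullMeasurableSet
    (measurableSet_le measurable_snd measurable_const).nullMeasurableSet

/-! ### Smooth approximations of half-line indicators -/

section SmoothApproximation

open Real (smoothTransition)

theorem contDiff_smoothTransition : ContDiff ℝ ∞ smoothTransition :=
  Real.smoothTransition.contDiff (n := ⊤)

theorem hasDerivAt_smoothTransition (x : ℝ) :
    HasDerivAt smoothTransition (deriv smoothTransition x) x :=
  (contDiff_smoothTransition.differentiable (by simp)).differentiableAt.hasDerivAt

theorem deriv_smoothTransition_nonneg (x : ℝ) : 0 ≤ deriv smoothTransition x :=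
  Real.smoothTransition.monotone.deriv_nonneg

theorem deriv_smoothTransition_of_lt_zero {x : ℝ} (hx : x < 0) : deriv smoothTransition x = 0 := by
  have : smoothTransition =ᶠ[𝓝 x] fun _ => 0 := by
    filter_upwards [gt_mem_nhds hx] with y hy
    exact Real.smoothTransition.zero_of_nonpos hy.le
  rw [this.deriv_eq, deriv_const]

theorem deriv_smoothTransition_of_one_lt {x : ℝ} (hx : 1 < x) : deriv smoothTransition x = 0 := by
  have : smoothTransition =ᶠ[𝓝 x] fun _ => 1 := by
    filter_upwards [lt_mem_nhds hx] with y hy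
    exact Real.smoothTransition.one_of_one_le hy.le
  rw [this.deriv_eq, deriv_const]

theorem continuous_deriv_smoothTransition : Continuous (deriv smoothTransition) :=
  contDiff_smoothTransition.continuous_deriv (by simp)

theorem exists_deriv_smoothTransition_le :
    ∃ C : ℝ, 0 ≤ C ∧ ∀ x, |deriv smoothTransition x| ≤ C := by
  obtain ⟨C, hC⟩ := (isCompact_Icc (a := (0 : ℝ)) (b := 1)).exists_bound_of_continuousOn
    continuous_deriv_smoothTransition.continuousOn
  have hC0 : 0 ≤ C := (norm_nonneg _).trans (hC 0 (by simp))
  refine ⟨C, hC0, fun x => ?_⟩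
  rcases lt_or_ge x 0 with h | h
  · rw [deriv_smoothTransition_of_lt_zero h]; simpa using hC0
  rcases lt_or_ge 1 x with h1 | h1
  · rw [deriv_smoothTransition_of_one_lt h1]; simpa using hC0
  exact hC x ⟨h, h1⟩

/-- A smooth step, equal to `1` on the right of `-(n + 1)` and to `0` on the left of
`-2 (n + 1)`. -/
noncomputable def leftCutoff (n : ℕ) (y : ℝ) : ℝ := smoothTransition (y / (n + 1) + 2)

/-- A smooth step, equal to `1` on the left of `0` and to `0` on the right of `1 / (n + 1)`. -/
noncomputable def stepDown (n : ℕ) (y : ℝ) : ℝ := 1 - smoothTransition ((n + 1) * y)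

theorem contDiff_leftCutoff (n : ℕ) : ContDiff ℝ ∞ (leftCutoff n) :=
  contDiff_smoothTransition.comp ((contDiff_id.div_const _).add contDiff_const)

theorem contDiff_stepDown (n : ℕ) : ContDiff ℝ ∞ (stepDown n) :=
  contDiff_const.sub (contDiff_smoothTransition.comp (contDiff_const.mul contDiff_id))

theorem hasDerivAt_leftCutoff (n : ℕ) (y : ℝ) :
    HasDerivAt (leftCutoff n) (deriv smoothTransition (y / (n + 1) + 2) / (n + 1)) y := by
  have h : HasDerivAt (leftCutoff n) _ y := (hasDerivAt_smoothTransition (y / (n + 1) + 2)).comp y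
    (((hasDerivAt_id y).div_const ((n : ℝ) + 1)).add_const 2)
  exact h.congr_deriv (by ring)

theorem hasDerivAt_stepDown (n : ℕ) (y : ℝ) :
    HasDerivAt (stepDown n) (-((n + 1) * deriv smoothTransition ((n + 1) * y))) y := by
  have h : HasDerivAt (stepDown n) _ y := ((hasDerivAt_smoothTransition ((n + 1) * y)).comp y
    ((hasDerivAt_id y).const_mul ((n : ℝ) + 1))).const_sub 1
  exact h.congr_deriv (by ring)

theorem leftCutoff_mem (n : ℕ) (y : ℝ) : leftCutoff n y ∈ Icc (0 : ℝ) 1 :=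
  ⟨Real.smoothTransition.nonneg _, Real.smoothTransition.le_one _⟩

theorem stepDown_mem (n : ℕ) (y : ℝ) : stepDown n y ∈ Icc (0 : ℝ) 1 :=
  ⟨sub_nonneg.2 (Real.smoothTransition.le_one _),
    sub_le_self _ (Real.smoothTransition.nonneg _)⟩

theorem leftCutoff_of_le {n : ℕ} {y : ℝ} (h : y ≤ -(2 * (n + 1))) : leftCutoff n y = 0 := by
  refine Real.smoothTransition.zero_of_nonpos ?_
  have hn : (0 : ℝ) < n + 1 := by positivity
  have : y / (n + 1) ≤ -2 := by rw [div_le_iff₀ hn]; linarith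
  linarith

theorem stepDown_of_one_le {n : ℕ} {y : ℝ} (h : 1 ≤ y) : stepDown n y = 0 := by
  have : (1 : ℝ) ≤ (n + 1) * y := by nlinarith [(Nat.cast_nonneg n : (0 : ℝ) ≤ n)]
  rw [stepDown, Real.smoothTransition.one_of_one_le this, sub_self]

theorem stepDown_of_nonpos {n : ℕ} {y : ℝ} (h : y ≤ 0) : stepDown n y = 1 := by
  have : (n + 1) * y ≤ 0 := mul_nonpos_of_nonneg_of_nonpos (by positivity) h
  rw [stepDown, Real.smoothTransition.zero_of_nonpos this, sub_zero]

theorem eventually_lt_natCast_add_one_mul (y : ℝ) {a : ℝ} (ha : 0 < a) :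
    ∀ᶠ n : ℕ in atTop, y < (n + 1) * a := by
  filter_upwards [(tendsto_natCast_atTop_atTop (R := ℝ)).eventually (eventually_gt_atTop (y / a))]
    with n hn
  rw [div_lt_iff₀ ha] at hn
  nlinarith

theorem eventually_leftCutoff_eq_one (y : ℝ) : ∀ᶠ n : ℕ in atTop, leftCutoff n y = 1 := by
  filter_upwards [eventually_lt_natCast_add_one_mul (-y) one_pos] with n hn
  refine Real.smoothTransition.one_of_one_le ?_
  have h0 : (0 : ℝ) < n + 1 := by positivity
  have : -1 ≤ y / (n + 1) := by rw [le_div_iff₀ h0]; linarith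
  linarith

theorem eventually_deriv_leftCutoff_eq_zero (y : ℝ) :
    ∀ᶠ n : ℕ in atTop, deriv (leftCutoff n) y = 0 := by
  filter_upwards [eventually_lt_natCast_add_one_mul (-y) one_pos] with n hn
  rw [(hasDerivAt_leftCutoff n y).deriv, deriv_smoothTransition_of_one_lt, zero_div]
  have h0 : (0 : ℝ) < n + 1 := by positivity
  have : -1 < y / (n + 1) := by rw [lt_div_iff₀ h0]; linarith
  linarith

theorem eventually_stepDown_eq (y : ℝ) :
    ∀ᶠ n : ℕ in atTop, stepDown n y = (Iic (0 : ℝ)).indicator 1 y := by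
  rcases le_or_gt y 0 with h | h
  · exact Eventually.of_forall fun n => by rw [stepDown_of_nonpos h]; simp [h]
  · filter_upwards [eventually_lt_natCast_add_one_mul 1 h] with n hn
    rw [stepDown, Real.smoothTransition.one_of_one_le hn.le]
    simp [h]

/-- Smooth compactly supported approximations of the indicator of `(-∞, x]` whose derivatives are
bounded above by a quantity tending to `0`. -/
theorem exists_smooth_approx_Iic (x : ℝ) : ∃ ψ : ℕ → ℝ → ℝ, (∀ n, ContDiff ℝ ∞ (ψ n)) ∧
    (∀ n, HasCompactSupport (ψ n)) ∧ (∀ n y, ψ n y ∈ Icc (0 : ℝ) 1) ∧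
    (∃ C : ℝ, 0 ≤ C ∧ ∀ n y, deriv (ψ n) y ≤ C / (n + 1)) ∧
    ∀ y, Tendsto (fun n => ψ n y) atTop (𝓝 ((Iic x).indicator 1 y)) := by
  obtain ⟨C, hC0, hC⟩ := exists_deriv_smoothTransition_le
  refine ⟨fun n y => leftCutoff n (y - x) * stepDown n (y - x), fun n => ?_, fun n => ?_,
    fun n y => ?_, ⟨C, hC0, fun n y => ?_⟩, fun y => ?_⟩
  · exact ((contDiff_leftCutoff n).mul (contDiff_stepDown n)).comp (contDiff_id.sub contDiff_const)
  · refine HasCompactSupport.intro (isCompact_Icc (a := x - 2 * (n + 1)) (b := x + 1)) fun y hy => ?_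
    beta_reduce
    rcases le_or_gt y (x - 2 * (n + 1)) with h | h
    · rw [leftCutoff_of_le (by linarith), zero_mul]
    · rw [stepDown_of_one_le, mul_zero]
      by_contra h1
      exact hy ⟨h.le, by linarith⟩
  · have h1 := leftCutoff_mem n (y - x)
    have h2 := stepDown_mem n (y - x)
    exact ⟨mul_nonneg h1.1 h2.1, mul_le_one₀ h1.2 h2.1 h2.2⟩
  · have hd := ((hasDerivAt_leftCutoff n (y - x)).mul
      (hasDerivAt_stepDown n (y - x))).comp_sub_const y x
    have hd' : deriv (fun y => leftCutoff n (y - x) * stepDown n (y - x)) y = _ := hd.deriv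
    rw [hd']
    have h1 := leftCutoff_mem n (y - x)
    have h2 := stepDown_mem n (y - x)
    have hn : (0 : ℝ) < n + 1 := by positivity
    have h3 : deriv smoothTransition ((y - x) / (n + 1) + 2) / (n + 1) * stepDown n (y - x)
        ≤ C / (n + 1) := by
      refine (mul_le_of_le_one_right (div_nonneg (deriv_smoothTransition_nonneg _) hn.le)
        h2.2).trans ?_
      gcongr
      exact (le_abs_self _).trans (hC _)
    -- The steep step is decreasing, so it only helps an upper bound; the bound comes from the slow
    -- left cutoff alone.
    have h4 : 0 ≤ leftCutoff n (y - x) * ((n + 1) * deriv smoothTransition ((n + 1) * (y - x))) :=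
      mul_nonneg h1.1 (mul_nonneg hn.le (deriv_smoothTransition_nonneg _))
    linarith
  · refine tendsto_const_nhds.congr' ?_
    filter_upwards [eventually_leftCutoff_eq_one (y - x), eventually_stepDown_eq (y - x)]
      with n h1 h2
    rw [h1, h2, one_mul]
    simp [indicator]

/-- Smooth compactly supported functions whose derivatives approximate the indicator of
`(-∞, x]`. -/
theorem exists_smooth_deriv_approx_Iic (x : ℝ) : ∃ ψ : ℕ → ℝ → ℝ, (∀ n, ContDiff ℝ ∞ (ψ n)) ∧
    (∀ n, HasCompactSupport (ψ n)) ∧ (∃ C : ℝ, ∀ n y, |deriv (ψ n) y| ≤ C) ∧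
    ∀ y, Tendsto (fun n => deriv (ψ n) y) atTop (𝓝 ((Iic x).indicator 1 y)) := by
  obtain ⟨C, hC0, hC⟩ := exists_deriv_smoothTransition_le
  have hcont : ∀ n, Continuous (stepDown n) := fun n => (contDiff_stepDown n).continuous
  -- The base point `1` makes this primitive vanish on the right of `1`; on the left a cutoff is
  -- still needed for compact support.
  set P : ℕ → ℝ → ℝ := fun n y => ∫ z in (1 : ℝ)..y, stepDown n z with hP
  have hPd : ∀ n y, HasDerivAt (P n) (stepDown n y) y := fun n y =>
    intervalIntegral.integral_hasDerivAt_right ((hcont n).intervalIntegrable _ _)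
      ((hcont n).stronglyMeasurableAtFilter _ _) (hcont n).continuousAt
  have hPs : ∀ n, ContDiff ℝ ∞ (P n) := fun n => by
    refine contDiff_infty_iff_deriv.2 ⟨fun y => (hPd n y).differentiableAt, ?_⟩
    have : deriv (P n) = stepDown n := funext fun y => (hPd n y).deriv
    rw [this]
    exact contDiff_stepDown n
  have hP0 : ∀ n y, 1 ≤ y → P n y = 0 := fun n y hy => by
    have : ∀ z ∈ uIcc (1 : ℝ) y, stepDown n z = 0 := fun z hz => by
      rw [uIcc_of_le hy] at hz
      exact stepDown_of_one_le hz.1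
    rw [hP]
    simp only
    rw [intervalIntegral.integral_congr this]
    simp
  have hPb : ∀ n y, |P n y| ≤ |y - 1| := fun n y => by
    have := intervalIntegral.norm_integral_le_of_norm_le_const (a := 1) (b := y)
      (f := stepDown n) (C := 1) fun z _ => by
        rw [Real.norm_eq_abs, abs_of_nonneg (stepDown_mem n z).1]; exact (stepDown_mem n z).2
    simpa using this
  have hd : ∀ n y, deriv (fun y => leftCutoff n (y - x) * P n (y - x)) y =
      deriv (leftCutoff n) (y - x) * P n (y - x) + leftCutoff n (y - x) * stepDown n (y - x) := by
    intro n y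
    have h := ((hasDerivAt_leftCutoff n (y - x)).mul (hPd n (y - x))).comp_sub_const y x
    rw [(hasDerivAt_leftCutoff n (y - x)).deriv]
    exact h.deriv
  refine ⟨fun n y => leftCutoff n (y - x) * P n (y - x), fun n => ?_, fun n => ?_,
    ⟨3 * C + 1, fun n y => ?_⟩, fun y => ?_⟩
  · exact ((contDiff_leftCutoff n).mul (hPs n)).comp (contDiff_id.sub contDiff_const)
  · refine HasCompactSupport.intro (isCompact_Icc (a := x - 2 * (n + 1)) (b := x + 1)) fun y hy => ?_
    beta_reduce
    rcases le_or_gt y (x - 2 * (n + 1)) with h | h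
    · rw [leftCutoff_of_le (by linarith), zero_mul]
    · rw [hP0, mul_zero]
      by_contra h1
      exact hy ⟨h.le, by linarith⟩
  · rw [hd]
    generalize y - x = z
    have h1 := leftCutoff_mem n z
    have h2 := stepDown_mem n z
    have hn : (1 : ℝ) ≤ n + 1 := by linarith [(Nat.cast_nonneg n : (0 : ℝ) ≤ n)]
    have hn0 : (0 : ℝ) < n + 1 := by linarith
    have h3 : |leftCutoff n z * stepDown n z| ≤ 1 := by
      rw [abs_of_nonneg (mul_nonneg h1.1 h2.1)]
      exact mul_le_one₀ h1.2 h2.1 h2.2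
    -- The cutoff has slope at most `C / (n + 1)`, and where the product survives the primitive is
    -- at most `2 * (n + 1) + 1 ≤ 3 * (n + 1)`.
    have h4 : |deriv (leftCutoff n) z * P n z| ≤ 3 * C := by
      rcases lt_or_ge z (-(2 * (n + 1))) with h | h
      · have : leftCutoff n =ᶠ[𝓝 z] fun _ => 0 := by
          filter_upwards [gt_mem_nhds h] with y hy
          exact leftCutoff_of_le hy.le
        rw [this.deriv_eq, deriv_const, zero_mul, abs_zero]
        positivity
      rcases lt_or_ge 1 z with h' | h'
      · rw [hP0 n z h'.le, mul_zero, abs_zero]; positivity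
      have hz : |z - 1| ≤ 3 * (n + 1) := by rw [abs_le]; constructor <;> linarith
      rw [(hasDerivAt_leftCutoff n z).deriv, abs_mul, abs_div, abs_of_pos hn0]
      calc |deriv smoothTransition (z / (n + 1) + 2)| / (n + 1) * |P n z|
          ≤ C / (n + 1) * (3 * (n + 1)) := by
            gcongr
            · exact hC _
            · exact (hPb n z).trans hz
        _ = 3 * C := by field_simp
    exact (abs_add_le _ _).trans (add_le_add h4 h3)
  · refine tendsto_const_nhds.congr' ?_
    filter_upwards [eventually_leftCutoff_eq_one (y - x), eventually_stepDown_eq (y - x),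
      eventually_deriv_leftCutoff_eq_zero (y - x)] with n h1 h2 h3
    rw [hd, h1, h2, h3, zero_mul, zero_add, one_mul]
    simp [indicator]

end SmoothApproximation

/-! ### From distributional to pointwise bounds in time -/

section WeakMonotonicity

open Real (smoothTransition)

/-- The derivative of a smooth step from `0` to `1` on `[a, a + δ]`. -/
noncomputable def stepKernel (δ a t : ℝ) : ℝ := deriv smoothTransition ((t - a) / δ) / δ

variable {δ : ℝ}

theorem hasDerivAt_step (δ a t : ℝ) :
    HasDerivAt (fun t => smoothTransition ((t - a) / δ)) (stepKernel δ a t) t := by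
  have h := (hasDerivAt_smoothTransition ((t - a) / δ)).comp t
    (((hasDerivAt_id t).sub_const a).div_const δ)
  exact h.congr_deriv (by rw [stepKernel]; ring)

theorem continuous_stepKernel (δ a : ℝ) : Continuous (stepKernel δ a) :=
  (continuous_deriv_smoothTransition.comp (by fun_prop)).div_const _

theorem stepKernel_nonneg (hδ : 0 < δ) (a t : ℝ) : 0 ≤ stepKernel δ a t :=
  div_nonneg (deriv_smoothTransition_nonneg _) hδ.le

theorem stepKernel_eq_zero (hδ : 0 < δ) (a : ℝ) {t : ℝ} (ht : t ∉ Icc a (a + δ)) :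
    stepKernel δ a t = 0 := by
  rw [stepKernel]
  rcases lt_or_ge t a with h | h
  · rw [deriv_smoothTransition_of_lt_zero (div_neg_of_neg_of_pos (by linarith) hδ), zero_div]
  · rw [deriv_smoothTransition_of_one_lt, zero_div]
    rw [lt_div_iff₀ hδ]
    by_contra h1
    exact ht ⟨h, by linarith⟩

theorem hasCompactSupport_stepKernel (hδ : 0 < δ) (a : ℝ) : HasCompactSupport (stepKernel δ a) :=
  HasCompactSupport.intro isCompact_Icc fun _ ht => stepKernel_eq_zero hδ a ht

theorem integrable_stepKernel_mul (hδ : 0 < δ) (a : ℝ) {G : ℝ → ℝ} (hG : Continuous G) :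
    Integrable fun t => stepKernel δ a t * G t :=
  ((continuous_stepKernel δ a).mul hG).integrable_of_hasCompactSupport
    (hasCompactSupport_stepKernel hδ a).mul_right

theorem integral_stepKernel (hδ : 0 < δ) (a : ℝ) : ∫ t, stepKernel δ a t = 1 := by
  have h1 : ∫ t in Icc a (a + δ), stepKernel δ a t = ∫ t, stepKernel δ a t :=
    setIntegral_eq_integral_of_forall_compl_eq_zero fun t ht => stepKernel_eq_zero hδ a ht
  rw [← h1, integral_Icc_eq_integral_Ioc, ← intervalIntegral.integral_of_le (by linarith),
    intervalIntegral.integral_eq_sub_of_hasDerivAt (fun t _ => hasDerivAt_step δ a t)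
      ((continuous_stepKernel δ a).intervalIntegrable _ _)]
  simp [hδ.ne']

theorem le_integral_stepKernel_mul (hδ : 0 < δ) (a c : ℝ) {G : ℝ → ℝ} (hG : Continuous G)
    (h : ∀ t ∈ Icc a (a + δ), c ≤ G t) : c ≤ ∫ t, stepKernel δ a t * G t := by
  have h1 : ∫ t, stepKernel δ a t * c = c := by
    rw [integral_mul_const, integral_stepKernel hδ, one_mul]
  rw [← h1]
  refine integral_mono (integrable_stepKernel_mul hδ a continuous_const)
    (integrable_stepKernel_mul hδ a hG) fun t => ?_
  by_cases ht : t ∈ Icc a (a + δ)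
  · exact mul_le_mul_of_nonneg_left (h t ht) (stepKernel_nonneg hδ a t)
  · simp [stepKernel_eq_zero hδ a ht]

theorem integral_stepKernel_mul_le (hδ : 0 < δ) (a c : ℝ) {G : ℝ → ℝ} (hG : Continuous G)
    (h : ∀ t ∈ Icc a (a + δ), G t ≤ c) : ∫ t, stepKernel δ a t * G t ≤ c := by
  have : -c ≤ ∫ t, stepKernel δ a t * -G t :=
    le_integral_stepKernel_mul hδ a (-c) hG.neg fun t ht => neg_le_neg (h t ht)
  simp only [mul_neg, integral_neg] at this
  linarith

/-- A continuous function whose distributional derivative on `(0, T)` is at least `-C` decreases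
at most at rate `C`. -/
theorem sub_le_of_weak_deriv_ge {G : ℝ → ℝ} (hG : Continuous G) {T C : ℝ} (hC : 0 ≤ C)
    (h : ∀ θ : ℝ → ℝ, ContDiff ℝ ∞ θ → HasCompactSupport θ → tsupport θ ⊆ Ioo 0 T →
      (∀ t, 0 ≤ θ t) → ∫ t, deriv θ t * G t ≤ C * ∫ t, θ t)
    {t₁ t₂ : ℝ} (h₁ : 0 ≤ t₁) (h₁₂ : t₁ ≤ t₂) (h₂ : t₂ ≤ T) :
    G t₁ - G t₂ ≤ C * (t₂ - t₁) := by
  have key : ∀ t₁ t₂ : ℝ, 0 < t₁ → t₁ ≤ t₂ → t₂ < T → G t₁ - G t₂ ≤ C * (t₂ - t₁) := by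
    intro t₁ t₂ h₁ h₁₂ h₂
    have main : ∀ ε : ℝ, 0 < ε → G t₁ - G t₂ ≤ C * (t₂ - t₁) + (2 + C) * ε := by
      intro ε hε
      obtain ⟨δ₁, hδ₁, hG₁⟩ := Metric.continuous_iff.1 hG t₁ ε hε
      obtain ⟨δ₂, hδ₂, hG₂⟩ := Metric.continuous_iff.1 hG t₂ ε hε
      obtain ⟨δ, hδ, hδm⟩ := exists_between
        (lt_min (lt_min hδ₁ hδ₂) (lt_min hε (sub_pos.2 h₂)))
      simp only [lt_min_iff] at hδm
      obtain ⟨⟨hd₁, hd₂⟩, hdε, hdT⟩ := hδm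
      -- A smoothed indicator of `[t₁, t₂]`: integrating `G` against its derivative gives an average
      -- of `G` just after `t₁` minus one just after `t₂`.
      set θ : ℝ → ℝ := fun t => smoothTransition ((t - t₁) / δ) - smoothTransition ((t - t₂) / δ)
        with hθ
      have hθ0 : ∀ t, 0 ≤ θ t := fun t => sub_nonneg.2 <| Real.smoothTransition.monotone <| by
        gcongr
      have hθ1 : ∀ t, θ t ≤ 1 := fun t => by
        have := Real.smoothTransition.le_one ((t - t₁) / δ)
        have := Real.smoothTransition.nonneg ((t - t₂) / δ)
        simp only [hθ]; linarith
      have hθs : ∀ t, t ∉ Icc t₁ (t₂ + δ) → θ t = 0 := by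
        intro t ht
        rcases lt_or_ge t t₁ with h' | h'
        · simp only [hθ]
          rw [Real.smoothTransition.zero_of_nonpos, Real.smoothTransition.zero_of_nonpos, sub_zero]
          · exact div_nonpos_of_nonpos_of_nonneg (by linarith) hδ.le
          · exact div_nonpos_of_nonpos_of_nonneg (by linarith) hδ.le
        · have h'' : t₂ + δ < t := by
            by_contra h1
            exact ht ⟨h', not_lt.1 h1⟩
          simp only [hθ]
          rw [Real.smoothTransition.one_of_one_le, Real.smoothTransition.one_of_one_le, sub_self]
          · rw [le_div_iff₀ hδ]; linarith
          · rw [le_div_iff₀ hδ]; linarith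
      have hθd : ∀ t, deriv θ t = stepKernel δ t₁ t - stepKernel δ t₂ t := fun t =>
        ((hasDerivAt_step δ t₁ t).sub (hasDerivAt_step δ t₂ t)).deriv
      have hsm : ContDiff ℝ ∞ θ :=
        (contDiff_smoothTransition.comp ((contDiff_id.sub contDiff_const).div_const _)).sub
          (contDiff_smoothTransition.comp ((contDiff_id.sub contDiff_const).div_const _))
      have hts : tsupport θ ⊆ Icc t₁ (t₂ + δ) :=
        closure_minimal (fun t ht => by_contra fun h' => ht (hθs t h')) isClosed_Icc
      have h3 := h θ hsm (HasCompactSupport.intro isCompact_Icc hθs)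
        (hts.trans fun t ht => ⟨by linarith [ht.1], by linarith [ht.2]⟩) hθ0
      simp only [hθd, sub_mul] at h3
      rw [integral_sub (integrable_stepKernel_mul hδ _ hG) (integrable_stepKernel_mul hδ _ hG)]
        at h3
      have h4 := le_integral_stepKernel_mul hδ t₁ (G t₁ - ε) hG fun t ht => by
        have := hG₁ t (by rw [Real.dist_eq, abs_of_nonneg] <;> linarith [ht.1, ht.2])
        rw [Real.dist_eq, abs_lt] at this
        linarith [this.1]
      have h5 := integral_stepKernel_mul_le hδ t₂ (G t₂ + ε) hG fun t ht => by
        have := hG₂ t (by rw [Real.dist_eq, abs_of_nonneg] <;> linarith [ht.1, ht.2])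
        rw [Real.dist_eq, abs_lt] at this
        linarith [this.2]
      have h6 : ∫ t, θ t ≤ t₂ + δ - t₁ := by
        rw [← setIntegral_eq_integral_of_forall_compl_eq_zero hθs]
        calc ∫ t in Icc t₁ (t₂ + δ), θ t ≤ ∫ t in Icc t₁ (t₂ + δ), (1 : ℝ) :=
              setIntegral_mono (hsm.continuous.integrableOn_Icc) (continuous_const.integrableOn_Icc)
                hθ1
          _ = t₂ + δ - t₁ := by
              rw [setIntegral_const, smul_eq_mul, mul_one, Real.volume_real_Icc_of_le (by linarith)]
      have h7 : C * ∫ t, θ t ≤ C * (t₂ + ε - t₁) :=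
        mul_le_mul_of_nonneg_left (h6.trans (by linarith)) hC
      nlinarith
    refine le_of_forall_pos_le_add fun ε hε => ?_
    have hC2 : 0 < 2 + C := by linarith
    have := main (ε / (2 + C)) (by positivity)
    rwa [mul_div_cancel₀ _ hC2.ne'] at this
  rcases h₁₂.eq_or_lt with rfl | hlt
  · simp
  -- Test functions see only the open interval; continuity of `G` recovers the endpoints.
  have hc : Tendsto (fun ε => G (t₁ + ε) - G (t₂ - ε)) (𝓝[>] 0) (𝓝 (G t₁ - G t₂)) := by
    have : Continuous fun ε => G (t₁ + ε) - G (t₂ - ε) := by fun_prop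
    simpa using (this.tendsto 0).mono_left nhdsWithin_le_nhds
  refine le_of_tendsto hc ?_
  have hp : 0 < (t₂ - t₁) / 2 := by linarith
  filter_upwards [Ioo_mem_nhdsGT hp] with ε hε
  refine (key (t₁ + ε) (t₂ - ε) (by linarith [hε.1]) (by linarith [hε.2])
    (by linarith [hε.1])).trans ?_
  exact mul_le_mul_of_nonneg_left (by linarith [hε.1]) hC

end WeakMonotonicity

/-! ### Continuity curves and finite speed of propagation -/

/-- `r` is a curve of probability measures, continuous in duality with compactly supported functions,
which solves the continuity equation on `(0, T) × ℝ` with a measurable velocity field `b` bounded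
by `K`. -/
structure IsContinuityCurve (T K : ℝ) (b : ℝ → ℝ → ℝ) (r : ℝ → Measure ℝ) : Prop where
  prob : ∀ t, IsProbabilityMeasure (r t)
  continuous : ∀ f : ℝ → ℝ, Continuous f → HasCompactSupport f → Continuous fun t => ∫ x, f x ∂(r t)
  measurable : Measurable (Function.uncurry b)
  bound : ∀ t x, |b t x| ≤ K
  equation : ∀ φ : ℝ × ℝ → ℝ, ContDiff ℝ ∞ φ → HasCompactSupport φ →
    tsupport φ ⊆ Ioo 0 T ×ˢ univ →
    ∫ t in Ioo 0 T, ∫ x, (deriv (fun s => φ (s, x)) t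
      + b t x * deriv (fun y => φ (t, y)) x) ∂(r t) = 0

theorem measurable_cdf_of_continuous {r : ℝ → Measure ℝ} (hp : ∀ t, IsProbabilityMeasure (r t))
    (hc : ∀ f : ℝ → ℝ, Continuous f → HasCompactSupport f → Continuous fun t => ∫ x, f x ∂(r t))
    (x : ℝ) : Measurable fun t => cdf (r t) x := by
  obtain ⟨ψ, hψ, hψc, hψ1, -, hψl⟩ := exists_smooth_approx_Iic x
  refine measurable_of_tendsto_metrizable
    (fun n => (hc (ψ n) (hψ n).continuous (hψc n)).measurable) ?_
  refine tendsto_pi_nhds.2 fun t => ?_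
  have := hp t
  have h1 : cdf (r t) x = ∫ y, (Iic x).indicator 1 y ∂(r t) := by
    rw [integral_indicator_one measurableSet_Iic, cdf_eq_real]
  rw [h1]
  refine tendsto_integral_of_dominated_convergence (fun _ => 1)
    (fun n => (hψ n).continuous.aestronglyMeasurable) (integrable_const _) (fun n => ?_)
    (Eventually.of_forall hψl)
  refine Eventually.of_forall fun y => ?_
  rw [Real.norm_eq_abs, abs_of_nonneg (hψ1 n y).1]
  exact (hψ1 n y).2

namespace IsContinuityCurve

variable {T K : ℝ} {b : ℝ → ℝ → ℝ} {r : ℝ → Measure ℝ}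

theorem measurable_quantile_uncurry (h : IsContinuityCurve T K b r) :
    Measurable fun p : ℝ × ℝ => quantile (r p.1) p.2 :=
  _root_.measurable_quantile_uncurry (measurable_cdf_of_continuous h.prob h.continuous)

theorem measurable_velocity (h : IsContinuityCurve T K b r) :
    Measurable fun p : ℝ × ℝ => b p.1 (quantile (r p.1) p.2) :=
  h.measurable.comp (measurable_fst.prodMk h.measurable_quantile_uncurry)

theorem bound_nonneg (h : IsContinuityCurve T K b r) : 0 ≤ K :=
  (abs_nonneg _).trans (h.bound 0 0)

/-- The continuity equation tested with `θ t * ψ (x - c * t)`, in terms of quantile functions. -/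
theorem integral_travelling_test (h : IsContinuityCurve T K b r) (c : ℝ) {θ ψ : ℝ → ℝ}
    (hθ : ContDiff ℝ ∞ θ) (hθc : HasCompactSupport θ) (hθs : tsupport θ ⊆ Ioo 0 T)
    (hψ : ContDiff ℝ ∞ ψ) (hψc : HasCompactSupport ψ) :
    ∫ t in Ioo 0 T, ∫ s, (deriv θ t * ψ (quantile (r t) s - c * t) +
      θ t * (deriv ψ (quantile (r t) s - c * t) * (b t (quantile (r t) s) - c))) ∂unif = 0 := by
  set φ : ℝ × ℝ → ℝ := fun p => θ p.1 * ψ (p.2 - c * p.1) with hφ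
  have hφd : ContDiff ℝ ∞ φ :=
    (hθ.comp contDiff_fst).mul
      (hψ.comp (contDiff_snd.sub (contDiff_const.mul contDiff_fst)))
  have hφc : HasCompactSupport φ := by
    refine HasCompactSupport.intro (K := (fun p : ℝ × ℝ => (p.1, p.2 + c * p.1)) ''
      (tsupport θ ×ˢ tsupport ψ)) ((hθc.isCompact.prod hψc.isCompact).image (by fun_prop)) ?_
    rintro ⟨t, x⟩ hp
    by_contra hne
    refine hp ⟨(t, x - c * t), ⟨subset_tsupport _ ?_, subset_tsupport _ ?_⟩, by simp⟩
    · exact left_ne_zero_of_mul hne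
    · exact right_ne_zero_of_mul hne
  have hφs : tsupport φ ⊆ Ioo 0 T ×ˢ univ := by
    have : tsupport φ ⊆ Prod.fst ⁻¹' tsupport θ :=
      closure_minimal (fun p hp => subset_tsupport _ (left_ne_zero_of_mul hp))
        ((isClosed_tsupport θ).preimage continuous_fst)
    exact fun p hp => ⟨hθs (this hp), mem_univ _⟩
  have hθ' : ∀ t, HasDerivAt θ (deriv θ t) t := fun t =>
    (hθ.differentiable (by simp)).differentiableAt.hasDerivAt
  have hψ' : ∀ t, HasDerivAt ψ (deriv ψ t) t := fun t =>
    (hψ.differentiable (by simp)).differentiableAt.hasDerivAt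
  have hd1 : ∀ t x, deriv (fun s => φ (s, x)) t =
      deriv θ t * ψ (x - c * t) + θ t * (deriv ψ (x - c * t) * (-c)) := by
    intro t x
    have h1 : HasDerivAt (fun s => ψ (x - c * s)) _ t :=
      (hψ' (x - c * t)).comp t (((hasDerivAt_id t).const_mul c).const_sub x)
    have h2 : HasDerivAt (fun s => φ (s, x)) _ t := (hθ' t).mul h1
    rw [h2.deriv]
    simp
  have hd2 : ∀ t x, deriv (fun y => φ (t, y)) x = θ t * deriv ψ (x - c * t) := by
    intro t x
    exact (((hψ' (x - c * t)).comp_sub_const x (c * t)).const_mul (θ t)).deriv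
  refine Eq.trans ?_ (h.equation φ hφd hφc hφs)
  refine integral_congr_ae (Eventually.of_forall fun t => ?_)
  beta_reduce
  have := h.prob t
  have hm : Measurable fun x => deriv θ t * ψ (x - c * t) +
      θ t * (deriv ψ (x - c * t) * (b t x - c)) := by
    have h1 := hψ.continuous.measurable
    have h2 : Measurable (deriv ψ) := measurable_deriv ψ
    have h3 : Measurable (b t) := h.measurable.comp measurable_prodMk_left
    fun_prop
  rw [← integral_quantile (r t) hm]
  refine integral_congr_ae (Eventually.of_forall fun x => ?_)
  beta_reduce
  rw [hd1, hd2]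
  ring

/-- Uniform continuity of `ψ` absorbs the moving shift, and weak continuity of the curve handles the
frozen one. -/
theorem continuous_integral_travelling (h : IsContinuityCurve T K b r) (c : ℝ) {ψ : ℝ → ℝ}
    (hψ : Continuous ψ) (hψc : HasCompactSupport ψ) :
    Continuous fun t => ∫ s, ψ (quantile (r t) s - c * t) ∂unif := by
  have hu : UniformContinuous ψ := hψ.uniformContinuous_of_tendsto_cocompact (hψc.is_zero_at_infty)
  obtain ⟨M, hM⟩ := hψc.exists_bound_of_continuous hψ
  have hint : ∀ t a, Integrable (fun s => ψ (quantile (r t) s - a)) unif := fun t a =>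
    Integrable.of_bound (hψ.measurable.comp
      ((measurable_quantile (r t)).sub_const a)).aestronglyMeasurable M
      (Eventually.of_forall fun s => hM _)
  rw [Metric.continuous_iff]
  intro t₀ ε hε
  obtain ⟨δ, hδ, hδψ⟩ := Metric.uniformContinuous_iff.1 hu (ε / 2) (half_pos hε)
  have hshift : HasCompactSupport fun x => ψ (x - c * t₀) :=
    hψc.comp_homeomorph (Homeomorph.subRight (c * t₀))
  have hc1 := h.continuous (fun x => ψ (x - c * t₀)) (hψ.comp (by fun_prop)) hshift
  have hc2 : ∀ᶠ t in 𝓝 t₀, dist (∫ x, ψ (x - c * t₀) ∂(r t)) (∫ x, ψ (x - c * t₀) ∂(r t₀)) < ε / 2 :=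
    Metric.tendsto_nhds.1 hc1.continuousAt _ (half_pos hε)
  have hc3 : ∀ᶠ t in 𝓝 t₀, dist (c * t) (c * t₀) < δ :=
    Metric.tendsto_nhds.1 (continuous_const.mul continuous_id).continuousAt _ hδ
  refine Metric.eventually_nhds_iff.1 ?_ |>.imp fun η hη => ⟨hη.1, fun t ht => hη.2 ht⟩
  filter_upwards [hc2, hc3] with t ht2 ht3
  have hmeas : Measurable fun x => ψ (x - c * t₀) := (hψ.comp (by fun_prop)).measurable
  have := h.prob t
  have := h.prob t₀
  rw [integral_quantile (r t) hmeas, integral_quantile (r t₀) hmeas] at ht2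
  have h1 : dist (∫ s, ψ (quantile (r t) s - c * t) ∂unif)
      (∫ s, ψ (quantile (r t) s - c * t₀) ∂unif) ≤ ε / 2 := by
    rw [dist_eq_norm, ← integral_sub (hint _ _) (hint _ _)]
    refine (norm_integral_le_of_norm_le_const (C := ε / 2) (Eventually.of_forall fun s => ?_)).trans
      (by simp)
    rw [← dist_eq_norm]
    refine (hδψ ?_).le
    rwa [dist_sub_left]
  exact (dist_triangle _ _ _).trans_lt (by linarith)

/-- The weak time derivative of the integral is the mean of `ψ' * (b - c)`. For `c = K` or `c = -K`
the second factor has a sign, so a one-sided bound on `ψ'` is enough: steep steps are allowed in one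
direction. -/
theorem integral_travelling_sub_le (h : IsContinuityCurve T K b r) (c : ℝ) {ψ : ℝ → ℝ}
    (hψ : ContDiff ℝ ∞ ψ) (hψc : HasCompactSupport ψ) {C : ℝ} (hC : 0 ≤ C)
    (hb : ∀ t x y, -C ≤ deriv ψ x * (b t y - c)) {t₁ t₂ : ℝ} (h₁ : 0 ≤ t₁) (h₁₂ : t₁ ≤ t₂)
    (h₂ : t₂ ≤ T) :
    (∫ s, ψ (quantile (r t₁) s - c * t₁) ∂unif) - ∫ s, ψ (quantile (r t₂) s - c * t₂) ∂unif
      ≤ C * (t₂ - t₁) := by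
  refine sub_le_of_weak_deriv_ge (h.continuous_integral_travelling c hψ.continuous hψc) hC
    (fun θ hθ hθc hθs hθ0 => ?_) h₁ h₁₂ h₂
  have hψd : Continuous (deriv ψ) := hψ.continuous_deriv (by simp)
  obtain ⟨M, hM⟩ := hψc.exists_bound_of_continuous hψ.continuous
  obtain ⟨M', hM'⟩ := hψc.deriv.exists_bound_of_continuous hψd
  have hM'0 : 0 ≤ M' := (norm_nonneg _).trans (hM' 0)
  have hX := h.measurable_quantile_uncurry
  have hv := h.measurable_velocity
  have hm2 : Measurable fun p : ℝ × ℝ =>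
      deriv ψ (quantile (r p.1) p.2 - c * p.1) * (b p.1 (quantile (r p.1) p.2) - c) :=
    (hψd.measurable.comp (hX.sub (measurable_fst.const_mul c))).mul (hv.sub_const c)
  have hb2 : ∀ t x y, ‖deriv ψ x * (b t y - c)‖ ≤ M' * (K + |c|) := fun t x y => by
    rw [norm_mul]
    refine mul_le_mul (hM' _) ?_ (norm_nonneg _) hM'0
    exact (norm_sub_le _ _).trans (add_le_add (h.bound _ _) le_rfl)
  have hi1 : ∀ t, Integrable (fun s => ψ (quantile (r t) s - c * t)) unif := fun t =>
    Integrable.of_bound (hψ.continuous.measurable.comp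
      ((measurable_quantile (r t)).sub_const _)).aestronglyMeasurable M
      (Eventually.of_forall fun s => hM _)
  have hi2 : ∀ t, Integrable (fun s => deriv ψ (quantile (r t) s - c * t) *
      (b t (quantile (r t) s) - c)) unif := fun t =>
    Integrable.of_bound (hm2.comp measurable_prodMk_left).aestronglyMeasurable (M' * (K + |c|))
      (Eventually.of_forall fun s => hb2 _ _ _)
  set G : ℝ → ℝ := fun t => ∫ s, ψ (quantile (r t) s - c * t) ∂unif with hG
  set g : ℝ → ℝ := fun t => ∫ s, deriv ψ (quantile (r t) s - c * t) *
      (b t (quantile (r t) s) - c) ∂unif with hg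
  have hGc : Continuous G := h.continuous_integral_travelling c hψ.continuous hψc
  have hgm : StronglyMeasurable g := hm2.stronglyMeasurable.integral_prod_right
  have hgb : ∀ t, ‖g t‖ ≤ M' * (K + |c|) := fun t =>
    (norm_integral_le_of_norm_le_const (Eventually.of_forall fun s => hb2 _ _ _)).trans (by simp)
  have hgl : ∀ t, -C ≤ g t := fun t => by
    have : ∫ s, -C ∂unif ≤ g t := integral_mono (integrable_const _) (hi2 t) fun s => hb _ _ _
    simpa using this
  have hid := h.integral_travelling_test c hθ hθc hθs hψ hψc
  have hsplit : ∀ t, ∫ s, (deriv θ t * ψ (quantile (r t) s - c * t) +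
      θ t * (deriv ψ (quantile (r t) s - c * t) * (b t (quantile (r t) s) - c))) ∂unif
      = deriv θ t * G t + θ t * g t := fun t => by
    rw [integral_add ((hi1 t).const_mul _) ((hi2 t).const_mul _), integral_const_mul,
      integral_const_mul]
  simp only [hsplit] at hid
  have hz : ∀ t, t ∉ Ioo 0 T → deriv θ t * G t + θ t * g t = 0 := fun t ht => by
    have h1 : t ∉ tsupport θ := fun h' => ht (hθs h')
    rw [image_eq_zero_of_notMem_tsupport h1, zero_mul, add_zero,
      image_eq_zero_of_notMem_tsupport (fun h' => h1 (tsupport_deriv_subset h'))]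
    simp
  rw [setIntegral_eq_integral_of_forall_compl_eq_zero hz] at hid
  have hI1 : Integrable fun t => deriv θ t * G t :=
    ((hθ.continuous_deriv (by simp)).mul hGc).integrable_of_hasCompactSupport hθc.deriv.mul_right
  have hIθ : Integrable θ := hθ.continuous.integrable_of_hasCompactSupport hθc
  have hI2 : Integrable fun t => θ t * g t :=
    hIθ.mul_bdd hgm.aestronglyMeasurable (Eventually.of_forall hgb)
  rw [integral_add hI1 hI2] at hid
  have h3 : ∫ t, θ t * (-C) ≤ ∫ t, θ t * g t :=
    integral_mono (hIθ.mul_const _) hI2 fun t => mul_le_mul_of_nonneg_left (hgl t) (hθ0 t)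
  rw [integral_mul_const] at h3
  linarith

/-- Mass cannot travel faster than the bound of the velocity field. -/
theorem cdf_le_cdf_add (h : IsContinuityCurve T K b r) {t₁ t₂ : ℝ} (h₁ : 0 ≤ t₁) (h₁₂ : t₁ ≤ t₂)
    (h₂ : t₂ ≤ T) (x : ℝ) :
    cdf (r t₁) x ≤ cdf (r t₂) (x + K * (t₂ - t₁)) ∧
      cdf (r t₂) x ≤ cdf (r t₁) (x + K * (t₂ - t₁)) := by
  have hK := h.bound_nonneg
  have hlim : ∀ (ψ : ℕ → ℝ → ℝ) (z c t : ℝ), (∀ n, ContDiff ℝ ∞ (ψ n)) →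
      (∀ n y, ψ n y ∈ Icc (0 : ℝ) 1) →
      (∀ y, Tendsto (fun n => ψ n y) atTop (𝓝 ((Iic z).indicator 1 y))) →
      Tendsto (fun n => ∫ s, ψ n (quantile (r t) s - c * t) ∂unif) atTop
        (𝓝 (cdf (r t) (z + c * t))) := by
    intro ψ z c t hψ hψ1 hψl
    have := h.prob t
    have h1 : cdf (r t) (z + c * t) =
        ∫ s, (Iic z).indicator 1 (quantile (r t) s - c * t) ∂unif := by
      rw [cdf_eq_real, ← integral_indicator_one measurableSet_Iic,
        integral_quantile (r t) (measurable_one.indicator measurableSet_Iic)]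
      refine integral_congr_ae (Eventually.of_forall fun s => ?_)
      simp [indicator]
    rw [h1]
    refine tendsto_integral_of_dominated_convergence (fun _ => 1)
      (fun n => ((hψ n).continuous.measurable.comp
        ((measurable_quantile (r t)).sub_const _)).aestronglyMeasurable)
      (integrable_const _) (fun n => ?_) (Eventually.of_forall fun s => hψl _)
    refine Eventually.of_forall fun y => ?_
    rw [Real.norm_eq_abs, abs_of_nonneg (hψ1 n _).1]
    exact (hψ1 n _).2
  have hrate : ∀ C : ℝ, Tendsto (fun n : ℕ => 2 * K * (C / (n + 1)) * (t₂ - t₁)) atTop (𝓝 0) := by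
    intro C
    have h0 := tendsto_const_div_atTop_nhds_zero_nat C
    have h1 : Tendsto (fun n : ℕ => C / ((n : ℝ) + 1)) atTop (𝓝 0) := by
      simpa using (tendsto_add_atTop_iff_nat 1).2 h0
    simpa using (h1.const_mul (2 * K)).mul_const (t₂ - t₁)
  constructor
  -- The half-line moves right at speed `K`, ending at `x` at time `t₁`; no mass can leave it.
  · obtain ⟨ψ, hψ, hψc, hψ1, ⟨C, hC0, hC⟩, hψl⟩ := exists_smooth_approx_Iic (x - K * t₁)
    have key : ∀ n : ℕ, (∫ s, ψ n (quantile (r t₁) s - K * t₁) ∂unif) -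
        ∫ s, ψ n (quantile (r t₂) s - K * t₂) ∂unif ≤ 2 * K * (C / (n + 1)) * (t₂ - t₁) := by
      intro n
      refine h.integral_travelling_sub_le K (hψ n) (hψc n) (by positivity) (fun t y z => ?_)
        h₁ h₁₂ h₂
      have h1 := abs_le.1 (h.bound t z)
      have h2 := hC n y
      have h3 : 0 ≤ C / ((n : ℝ) + 1) := by positivity
      nlinarith [mul_nonneg (sub_nonneg.2 h2) (sub_nonneg.2 h1.2)]
    have hl := le_of_tendsto_of_tendsto' ((hlim ψ _ K t₁ hψ hψ1 hψl).sub
      (hlim ψ _ K t₂ hψ hψ1 hψl)) (hrate C) key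
    have e1 : x - K * t₁ + K * t₁ = x := by ring
    have e2 : x - K * t₁ + K * t₂ = x + K * (t₂ - t₁) := by ring
    rw [e1, e2] at hl
    linarith
  -- The half-line moves left at speed `K`, ending at `x` at time `t₂`; no mass can enter it, whence
  -- the test function `-ψ`.
  · obtain ⟨ψ, hψ, hψc, hψ1, ⟨C, hC0, hC⟩, hψl⟩ := exists_smooth_approx_Iic (x + K * t₂)
    have key : ∀ n : ℕ, (∫ s, ψ n (quantile (r t₂) s - -K * t₂) ∂unif) -
        ∫ s, ψ n (quantile (r t₁) s - -K * t₁) ∂unif ≤ 2 * K * (C / (n + 1)) * (t₂ - t₁) := by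
      intro n
      have h5 := h.integral_travelling_sub_le (-K) (hψ n).neg (hψc n).neg
        (C := 2 * K * (C / (n + 1))) (by positivity) (fun t y z => ?_) h₁ h₁₂ h₂
      · simp only [integral_neg] at h5
        linarith
      have h1 := abs_le.1 (h.bound t z)
      have h2 := hC n y
      have h3 : 0 ≤ C / ((n : ℝ) + 1) := by positivity
      rw [deriv.fun_neg]
      nlinarith [mul_nonneg (sub_nonneg.2 h2) (neg_le_iff_add_nonneg.1 h1.1)]
    have hl := le_of_tendsto_of_tendsto' ((hlim ψ _ (-K) t₂ hψ hψ1 hψl).sub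
      (hlim ψ _ (-K) t₁ hψ hψ1 hψl)) (hrate C) key
    have e1 : x + K * t₂ + -K * t₂ = x := by ring
    have e2 : x + K * t₂ + -K * t₁ = x + K * (t₂ - t₁) := by ring
    rw [e1, e2] at hl
    linarith

/-- The Galois connection inverts the two cdf inequalities. The bound holds for every `s`, thanks to
the value `0` outside `(0, 1)`. -/
theorem abs_quantile_sub_le (h : IsContinuityCurve T K b r) (s : ℝ) {t₁ t₂ : ℝ}
    (h₁ : t₁ ∈ Icc 0 T) (h₂ : t₂ ∈ Icc 0 T) :
    |quantile (r t₁) s - quantile (r t₂) s| ≤ K * |t₁ - t₂| := by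
  wlog h₁₂ : t₁ ≤ t₂ generalizing t₁ t₂
  · rw [abs_sub_comm, abs_sub_comm t₁]
    exact this h₂ h₁ (le_of_not_ge h₁₂)
  by_cases hs : s ∈ Ioo (0 : ℝ) 1
  · have hF := h.cdf_le_cdf_add h₁.1 h₁₂ h₂.2
    rw [abs_sub_comm t₁, abs_of_nonneg (sub_nonneg.2 h₁₂)]
    have h1 := (quantile_le_iff (r t₁) hs (quantile (r t₂) s + K * (t₂ - t₁))).2
      (((quantile_le_iff (r t₂) hs _).1 le_rfl).trans (hF _).2)
    have h2 := (quantile_le_iff (r t₂) hs (quantile (r t₁) s + K * (t₂ - t₁))).2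
      (((quantile_le_iff (r t₁) hs _).1 le_rfl).trans (hF _).1)
    rw [abs_le]
    constructor <;> linarith
  · rw [quantile_of_notMem _ hs, quantile_of_notMem _ hs, sub_self, abs_zero]
    exact mul_nonneg h.bound_nonneg (abs_nonneg _)

end IsContinuityCurve

/-! ### Quantiles are characteristics -/

/-- A function on `(0, 1)` that is constant on the level sets of a quantile function and whose
integrals over the sublevel sets vanish is zero almost everywhere. -/
theorem ae_eq_zero_of_setIntegral_quantile_le {μ : Measure ℝ} {u : ℝ → ℝ} (hu : Integrable u unif)
    {S : Set ℝ} (hS : ∀ᵐ s ∂unif, s ∈ S)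
    (hconst : ∀ s ∈ S, ∀ s' ∈ S, s ∈ Ioo (0 : ℝ) 1 → s' ∈ Ioo (0 : ℝ) 1 →
      quantile μ s = quantile μ s' → u s = u s')
    (hint : ∀ q : ℚ, ∫ s in {s | quantile μ s ≤ q}, u s ∂unif = 0) :
    ∀ᵐ s ∂unif, u s = 0 := by
  have hii : IntervalIntegrable u volume 0 1 := by
    rw [intervalIntegrable_iff, uIoc_of_le zero_le_one]
    exact (integrableOn_Ioc_iff_integrableOn_Ioo).2 hu
  set U : ℝ → ℝ := fun p => ∫ s in (0 : ℝ)..p, u s with hU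
  have hUac : AbsolutelyContinuousOnInterval U 0 1 :=
    hii.absolutelyContinuousOnInterval_intervalIntegral left_mem_uIcc
  have hUc : ContinuousOn U (Icc 0 1) := by simpa using hUac.continuousOn
  have hcm : ∀ y, cdf μ y ∈ Icc (0 : ℝ) 1 := fun y => ⟨cdf_nonneg μ y, cdf_le_one μ y⟩
  have hUq : ∀ q : ℚ, U (cdf μ q) = 0 := fun q => by
    rw [← hint q, hU, Measure.restrict_restrict (measurableSet_quantile_le μ q)]
    simp only
    rw [intervalIntegral.integral_of_le (cdf_nonneg μ q)]
    exact setIntegral_congr_set (quantile_le_ae_eq μ q).symm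
  have hUr : ∀ y, U (cdf μ y) = 0 := fun y => by
    by_contra hne
    have h1 : ContinuousWithinAt (fun y => U (cdf μ y)) (Ioi y) y :=
      ((hUc _ (hcm y)).comp ((cdf μ).right_continuous y) fun z _ => hcm z).mono Ioi_subset_Ici_self
    obtain ⟨z, hz, hyz⟩ := mem_nhdsGT_iff_exists_Ioo_subset.1
      (h1.eventually_ne hne)
    obtain ⟨q, hq1, hq2⟩ := exists_rat_btwn (mem_Ioi.1 hz)
    exact hyz ⟨hq1, hq2⟩ (hUq q)
  have hleft : ∀ x, Tendsto (cdf μ) (𝓝[<] x) (𝓝 (Function.leftLim (cdf μ) x)) := fun x =>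
    (monotone_cdf μ).tendsto_leftLim x
  have hUl : ∀ x, U (Function.leftLim (cdf μ) x) = 0 := fun x => by
    have hmem : Function.leftLim (cdf μ) x ∈ Icc (0 : ℝ) 1 :=
      isClosed_Icc.mem_of_tendsto (hleft x) (Eventually.of_forall hcm)
    have h1 : Tendsto (fun y => U (cdf μ y)) (𝓝[<] x) (𝓝 (U (Function.leftLim (cdf μ) x))) :=
      (hUc _ hmem).tendsto.comp (tendsto_nhdsWithin_iff.2 ⟨hleft x, Eventually.of_forall hcm⟩)
    simp only [hUr] at h1
    exact tendsto_nhds_unique h1 tendsto_const_nhds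
  have hS' : ∀ᵐ s : ℝ, s ∈ Ioo (0 : ℝ) 1 → s ∈ S := (ae_restrict_iff' measurableSet_Ioo).1 hS
  -- Let `x` be the quantile at `s`. Without an atom at `x`, `s` is the left limit of the cdf there
  -- and `U s = 0`. With an atom, `u` is almost everywhere equal to `u s` on the jump interval,
  -- where its integral is zero, so `u s = 0`.
  have hUu : ∀ s ∈ S, s ∈ Ioo (0 : ℝ) 1 → U s * u s = 0 := by
    intro s hs hs1
    set x := quantile μ s with hx
    set c := Function.leftLim (cdf μ) x with hc
    have hsx : s ≤ cdf μ x := (quantile_le_iff μ hs1 x).1 le_rfl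
    have hcs : c ≤ s := by
      refine le_of_tendsto (hleft x) ?_
      filter_upwards [self_mem_nhdsWithin] with y hy
      by_contra h1
      exact absurd ((quantile_le_iff μ hs1 y).2 (not_le.1 h1).le) (not_le.2 hy)
    rcases (hcs.trans hsx).eq_or_lt with heq | hlt
    · rw [le_antisymm (hsx.trans heq.symm.le) hcs, hUl, zero_mul]
    · have hc0 : 0 ≤ c := ge_of_tendsto (hleft x) (Eventually.of_forall fun y => cdf_nonneg μ y)
      have h0 : ∫ p in c..cdf μ x, u p = 0 := by
        have hsub : ∀ p ∈ Icc (0 : ℝ) 1, IntervalIntegrable u volume 0 p := fun p hp =>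
          hii.mono_set (by rw [uIcc_of_le hp.1, uIcc_of_le zero_le_one]; exact Icc_subset_Icc_right hp.2)
        have := intervalIntegral.integral_interval_sub_left (hsub _ (hcm x))
          (hsub c ⟨hc0, hlt.le.trans (hcm x).2⟩)
        rw [← this]
        change U (cdf μ x) - U c = 0
        rw [hUr, hUl, sub_zero]
      have h1 : ∫ p in c..cdf μ x, u p = ∫ _p in c..cdf μ x, u s := by
        refine intervalIntegral.integral_congr_ae ?_
        have hne : ∀ᵐ p : ℝ, p ≠ 1 := by simp [ae_iff]
        filter_upwards [hS', hne] with p hp hp1 hpc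
        rw [uIoc_of_le hlt.le] at hpc
        have hp2 : p ∈ Ioo (0 : ℝ) 1 :=
          ⟨hc0.trans_lt hpc.1, lt_of_le_of_ne (hpc.2.trans (hcm x).2) hp1⟩
        refine hconst p (hp hp2) s hs hp2 hs1 (le_antisymm ((quantile_le_iff μ hp2 x).2 hpc.2) ?_)
        refine le_of_forall_lt fun y hy => ?_
        by_contra h3
        have h4 := (quantile_le_iff μ hp2 y).1 (not_lt.1 h3)
        exact absurd ((monotone_cdf μ).le_leftLim hy) (not_le.2 (hpc.1.trans_le h4))
      rw [h0, intervalIntegral.integral_const, smul_eq_mul, eq_comm] at h1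
      rw [(mul_eq_zero.1 h1).resolve_left (sub_pos.2 hlt).ne', mul_zero]
  have hd : ∀ᵐ s : ℝ, s ∈ Ioo (0 : ℝ) 1 → HasDerivAt U (u s) s := by
    filter_upwards [hii.ae_hasDerivAt_integral] with s hs hs1
    exact hs (by rw [uIcc_of_le zero_le_one]; exact Ioo_subset_Icc_self hs1) 0 (by simp)
  -- The square of `U` has derivative `2 * U * u = 0` almost everywhere and is absolutely
  -- continuous, hence constant.
  obtain ⟨C, hC⟩ := (hUac.mul hUac).const_of_ae_hasDerivAt_zero (by
    have hne0 : ∀ᵐ p : ℝ, p ≠ 0 := by simp [ae_iff]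
    have hne1 : ∀ᵐ p : ℝ, p ≠ 1 := by simp [ae_iff]
    filter_upwards [hd, hS', hne0, hne1] with s h1 h2 h3 h4 h5
    rw [uIcc_of_le zero_le_one] at h5
    have h6 : s ∈ Ioo (0 : ℝ) 1 := ⟨lt_of_le_of_ne h5.1 h3.symm, lt_of_le_of_ne h5.2 h4⟩
    have h7 := (h1 h6).mul (h1 h6)
    rwa [mul_comm (u s), hUu s (h2 h6) h6, add_zero] at h7)
  rw [uIcc_of_le zero_le_one] at hC
  have hC0 : C = 0 := by
    rw [← hC 0 (by simp)]
    simp [hU]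
  have hU0 : ∀ s ∈ Icc (0 : ℝ) 1, U s = 0 := fun s hs =>
    mul_self_eq_zero.1 ((hC s hs).trans hC0)
  refine (ae_restrict_iff' measurableSet_Ioo).2 ?_
  filter_upwards [hd] with s h1 hs
  have h2 : U =ᶠ[𝓝 s] fun _ => 0 := by
    filter_upwards [isOpen_Ioo.mem_nhds hs] with p hp
    exact hU0 p (Ioo_subset_Icc_self hp)
  exact (h1 hs).unique ((hasDerivAt_const s (0 : ℝ)).congr_of_eventuallyEq h2)

theorem HasDerivAt.tendsto_forward_quotient {f : ℝ → ℝ} {f' t : ℝ} (hf : HasDerivAt f f' t) :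
    Tendsto (fun n : ℕ => (n + 1) * (f (t + 1 / (n + 1)) - f t)) atTop (𝓝 f') := by
  have h1 : Tendsto (fun n : ℕ => (1 : ℝ) / ((n : ℝ) + 1)) atTop (𝓝[≠] 0) :=
    tendsto_nhdsWithin_iff.2 ⟨tendsto_one_div_add_atTop_nhds_zero_nat,
      Eventually.of_forall fun n => by
        have : (0 : ℝ) < 1 / ((n : ℝ) + 1) := by positivity
        exact this.ne'⟩
  have h2 := (hasDerivAt_iff_tendsto_slope_zero.1 hf).comp h1
  refine h2.congr fun n => ?_
  simp

theorem HasDerivAt.tendsto_backward_quotient {f : ℝ → ℝ} {f' t : ℝ} (hf : HasDerivAt f f' t) :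
    Tendsto (fun n : ℕ => (n + 1) * (f t - f (t - 1 / (n + 1)))) atTop (𝓝 f') := by
  have h1 : Tendsto (fun n : ℕ => -((1 : ℝ) / ((n : ℝ) + 1))) atTop (𝓝[≠] 0) :=
    tendsto_nhdsWithin_iff.2 ⟨by
      simpa using (tendsto_one_div_add_atTop_nhds_zero_nat (𝕜 := ℝ)).neg,
      Eventually.of_forall fun n => by
        have : (0 : ℝ) < 1 / ((n : ℝ) + 1) := by positivity
        exact (neg_neg_of_pos this).ne⟩
  have h2 := (hasDerivAt_iff_tendsto_slope_zero.1 hf).comp h1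
  refine h2.congr fun n => ?_
  simp only [Function.comp, smul_eq_mul, inv_neg, one_div, inv_inv, sub_eq_add_neg]
  ring

namespace IsContinuityCurve

variable {T K : ℝ} {b : ℝ → ℝ → ℝ} {r : ℝ → Measure ℝ}

theorem lipschitzOnWith_quantile (h : IsContinuityCurve T K b r) (s : ℝ) :
    LipschitzOnWith K.toNNReal (fun t => quantile (r t) s) (Icc 0 T) :=
  LipschitzOnWith.of_dist_le_mul fun t₁ h₁ t₂ h₂ => by
    rw [Real.coe_toNNReal _ h.bound_nonneg]
    exact h.abs_quantile_sub_le s h₁ h₂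

theorem ae_differentiableAt_quantile (h : IsContinuityCurve T K b r) (hT : 0 ≤ T) (s : ℝ) :
    ∀ᵐ t ∂(volume.restrict (Ioo 0 T)), DifferentiableAt ℝ (fun t => quantile (r t) s) t := by
  have h1 : AbsolutelyContinuousOnInterval (fun t => quantile (r t) s) 0 T :=
    LipschitzOnWith.absolutelyContinuousOnInterval (K := K.toNNReal)
      (by rw [uIcc_of_le hT]; exact h.lipschitzOnWith_quantile s)
  refine (ae_restrict_iff' measurableSet_Ioo).2 ?_
  filter_upwards [h1.ae_differentiableAt] with t ht ht1
  exact ht (by rw [uIcc_of_le hT]; exact Ioo_subset_Icc_self ht1)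

/-- Almost every particle has, at almost every time, a velocity, which is a measurable function
bounded by `K`; at almost every time, particles at the same place have the same velocity. -/
theorem exists_particle_velocity (h : IsContinuityCurve T K b r) (hT : 0 ≤ T) :
    ∃ v : ℝ × ℝ → ℝ, Measurable v ∧ (∀ p, |v p| ≤ K) ∧
      (∀ s, ∀ᵐ t ∂(volume.restrict (Ioo 0 T)), HasDerivAt (fun t => quantile (r t) s) (v (t, s)) t) ∧
      ∃ S : Set (ℝ × ℝ), (∀ᵐ t ∂(volume.restrict (Ioo 0 T)), ∀ᵐ s ∂unif, (t, s) ∈ S) ∧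
        ∀ t s s', (t, s) ∈ S → (t, s') ∈ S → s ∈ Ioo (0 : ℝ) 1 → s' ∈ Ioo (0 : ℝ) 1 →
          quantile (r t) s = quantile (r t) s' → v (t, s) = v (t, s') := by
  have hK := h.bound_nonneg
  have hX := h.measurable_quantile_uncurry
  set q : ℕ → ℝ × ℝ → ℝ := fun n p =>
    (n + 1) * (quantile (r (p.1 + 1 / (n + 1))) p.2 - quantile (r p.1) p.2) with hq
  set m : ℕ → ℝ × ℝ → ℝ := fun n p =>
    (n + 1) * (quantile (r p.1) p.2 - quantile (r (p.1 - 1 / (n + 1))) p.2) with hm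
  have hqm : ∀ n, Measurable (q n) := fun n =>
    ((hX.comp ((measurable_fst.add_const _).prodMk measurable_snd)).sub hX).const_mul _
  have hmm : ∀ n, Measurable (m n) := fun n =>
    (hX.sub (hX.comp ((measurable_fst.sub_const _).prodMk measurable_snd))).const_mul _
  -- A limsup of difference quotients along a sequence is measurable on the whole plane; clamping
  -- gives the bound everywhere without changing a genuine derivative.
  set v : ℝ × ℝ → ℝ := fun p => max (-K) (min K (limsup (fun n => q n p) atTop)) with hv
  have hvm : Measurable v := measurable_const.max (measurable_const.min (Measurable.limsup hqm))
  have hvK : ∀ p, |v p| ≤ K := fun p => abs_le.2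
    ⟨le_max_left _ _, max_le (by linarith) (min_le_left _ _)⟩
  set S : Set (ℝ × ℝ) := {p | Tendsto (fun n => q n p) atTop (𝓝 (v p))} ∩
    {p | Tendsto (fun n => m n p) atTop (𝓝 (v p))} with hS
  have hSm : MeasurableSet S :=
    (measurableSet_tendsto_fun hqm hvm).inter (measurableSet_tendsto_fun hmm hvm)
  have hd : ∀ s, ∀ᵐ t ∂(volume.restrict (Ioo 0 T)),
      HasDerivAt (fun t => quantile (r t) s) (v (t, s)) t := by
    intro s
    filter_upwards [h.ae_differentiableAt_quantile hT s, ae_restrict_mem measurableSet_Ioo]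
      with t ht ht0
    have h1 := ht.hasDerivAt
    have h2 : limsup (fun n => q n (t, s)) atTop = deriv (fun t => quantile (r t) s) t :=
      h1.tendsto_forward_quotient.limsup_eq
    have h3 : ‖deriv (fun t => quantile (r t) s) t‖ ≤ K.toNNReal :=
      norm_deriv_le_of_lipschitzOn (Icc_mem_nhds ht0.1 ht0.2) (h.lipschitzOnWith_quantile s)
    rw [Real.coe_toNNReal _ hK, Real.norm_eq_abs, abs_le] at h3
    have h4 : v (t, s) = deriv (fun t => quantile (r t) s) t := by
      simp only [hv]
      rw [h2, min_eq_right h3.2, max_eq_right h3.1]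
    rwa [h4]
  refine ⟨v, hvm, hvK, hd, S, ?_, ?_⟩
  · refine (Measure.ae_ae_comm (p := fun s t => (t, s) ∈ S) (measurable_swap hSm)).1
      (Eventually.of_forall fun s => ?_)
    filter_upwards [hd s] with t ht
    exact ⟨ht.tendsto_forward_quotient, ht.tendsto_backward_quotient⟩
  -- Two particles that meet at time `t` keep their order before and after. Forward quotients give
  -- `v (t, s) ≤ v (t, s')`, backward quotients the reverse.
  · have key : ∀ t s s', (t, s) ∈ S → (t, s') ∈ S → s ∈ Ioo (0 : ℝ) 1 → s' ∈ Ioo (0 : ℝ) 1 →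
        quantile (r t) s = quantile (r t) s' → s ≤ s' → v (t, s) = v (t, s') := by
      intro t s s' hs hs' hs1 hs1' heq hle
      refine le_antisymm (le_of_tendsto_of_tendsto' hs.1 hs'.1 fun n => ?_)
        (le_of_tendsto_of_tendsto' hs'.2 hs.2 fun n => ?_)
      · have := quantile_mono (r (t + 1 / (n + 1))) hs1 hs1' hle
        simp only [hq]
        rw [heq]
        gcongr
      · have := quantile_mono (r (t - 1 / (n + 1))) hs1 hs1' hle
        simp only [hm]
        rw [heq]
        gcongr
    intro t s s' hs hs' hs1 hs1' heq
    rcases le_total s s' with hle | hle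
    · exact key t s s' hs hs' hs1 hs1' heq hle
    · exact (key t s' s hs' hs hs1' hs1 heq.symm hle).symm

/-- Particles move, in the weak sense, with the velocity field. -/
theorem integral_test_particle_velocity (h : IsContinuityCurve T K b r) (hT : 0 ≤ T)
    {v : ℝ × ℝ → ℝ} (hv : Measurable v) (hvK : ∀ p, |v p| ≤ K)
    (hvd : ∀ s, ∀ᵐ t ∂(volume.restrict (Ioo 0 T)),
      HasDerivAt (fun t => quantile (r t) s) (v (t, s)) t)
    {θ ψ : ℝ → ℝ} (hθ : ContDiff ℝ ∞ θ) (hθc : HasCompactSupport θ) (hθs : tsupport θ ⊆ Ioo 0 T)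
    (hψ : ContDiff ℝ ∞ ψ) (hψc : HasCompactSupport ψ) :
    ∫ p, θ p.1 * (deriv ψ (quantile (r p.1) p.2) * (v p - b p.1 (quantile (r p.1) p.2)))
      ∂((volume.restrict (Ioo 0 T)).prod unif) = 0 := by
  have hX := h.measurable_quantile_uncurry
  have hbm := h.measurable_velocity
  have hθd : Continuous (deriv θ) := hθ.continuous_deriv (by simp)
  have hψd : Continuous (deriv ψ) := hψ.continuous_deriv (by simp)
  obtain ⟨A, hA⟩ := hθc.exists_bound_of_continuous hθ.continuous
  obtain ⟨A', hA'⟩ := hθc.deriv.exists_bound_of_continuous hθd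
  obtain ⟨M, hM⟩ := hψc.exists_bound_of_continuous hψ.continuous
  obtain ⟨M', hM'⟩ := hψc.deriv.exists_bound_of_continuous hψd
  have hA0 : 0 ≤ A := (norm_nonneg _).trans (hA 0)
  have hA'0 : 0 ≤ A' := (norm_nonneg _).trans (hA' 0)
  have hM'0 : 0 ≤ M' := (norm_nonneg _).trans (hM' 0)
  set π : Measure (ℝ × ℝ) := (volume.restrict (Ioo 0 T)).prod unif with hπ
  have hfin : IsFiniteMeasure (volume.restrict (Ioo 0 T)) := ⟨by simp⟩
  have hI1 : Integrable (fun p : ℝ × ℝ => deriv θ p.1 * ψ (quantile (r p.1) p.2)) π := by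
    refine Integrable.of_bound ((hθd.measurable.comp measurable_fst).mul
      (hψ.continuous.measurable.comp hX)).aestronglyMeasurable (A' * M)
      (Eventually.of_forall fun p => ?_)
    rw [norm_mul]
    exact mul_le_mul (hA' _) (hM _) (norm_nonneg _) hA'0
  have hIw : ∀ w : ℝ × ℝ → ℝ, Measurable w → (∀ p, |w p| ≤ K) →
      Integrable (fun p : ℝ × ℝ => θ p.1 * (deriv ψ (quantile (r p.1) p.2) * w p)) π := by
    intro w hw hwK
    refine Integrable.of_bound ((hθ.continuous.measurable.comp measurable_fst).mul
      ((hψd.measurable.comp hX).mul hw)).aestronglyMeasurable (A * (M' * K))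
      (Eventually.of_forall fun p => ?_)
    rw [norm_mul, norm_mul]
    exact mul_le_mul (hA _) (mul_le_mul (hM' _) (hwK _) (norm_nonneg _) hM'0) (by positivity) hA0
  have hIv := hIw v hv hvK
  have hIb := hIw _ hbm fun p => h.bound _ _
  have hb : ∫ p, (deriv θ p.1 * ψ (quantile (r p.1) p.2) +
      θ p.1 * (deriv ψ (quantile (r p.1) p.2) * b p.1 (quantile (r p.1) p.2))) ∂π = 0 := by
    refine (integral_prod _ (hI1.add hIb)).trans ?_
    simpa using h.integral_travelling_test 0 hθ hθc hθs hψ hψc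
  -- For fixed `s` the integrand is the derivative of `θ t * ψ (X t s)`, a product of absolutely
  -- continuous functions vanishing at `0` and `T`.
  have hv0 : ∫ p, (deriv θ p.1 * ψ (quantile (r p.1) p.2) +
      θ p.1 * (deriv ψ (quantile (r p.1) p.2) * v p)) ∂π = 0 := by
    refine (integral_prod_symm _ (hI1.add hIv)).trans ?_
    refine integral_eq_zero_of_ae (Eventually.of_forall fun s => ?_)
    simp only [Pi.add_apply, Pi.zero_apply]
    have hac1 : AbsolutelyContinuousOnInterval θ 0 T :=
      ((hθ.of_le (m := 1) (by simp)).contDiffOn).absolutelyContinuousOnInterval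
    have hlip : ∃ C, LipschitzWith C ψ :=
      hψ.lipschitzWith_of_hasCompactSupport hψc (by simp)
    obtain ⟨C, hC⟩ := hlip
    have hac2 : AbsolutelyContinuousOnInterval (fun t => ψ (quantile (r t) s)) 0 T :=
      LipschitzOnWith.absolutelyContinuousOnInterval (K := C * K.toNNReal)
        (by rw [uIcc_of_le hT]; exact hC.comp_lipschitzOnWith (h.lipschitzOnWith_quantile s))
    have hθ0 : θ 0 = 0 := image_eq_zero_of_notMem_tsupport fun h' => lt_irrefl _ (hθs h').1
    have hθT : θ T = 0 := image_eq_zero_of_notMem_tsupport fun h' => lt_irrefl _ (hθs h').2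
    have h1 := hac1.integral_deriv_mul_eq_sub hac2
    rw [hθ0, hθT, zero_mul, zero_mul, sub_zero, intervalIntegral.integral_of_le hT,
      integral_Ioc_eq_integral_Ioo] at h1
    refine Eq.trans (integral_congr_ae ?_) h1
    filter_upwards [hvd s] with t ht
    have h2 : HasDerivAt (fun t => ψ (quantile (r t) s))
        (deriv ψ (quantile (r t) s) * v (t, s)) t :=
      ((hψ.differentiable (by simp)).differentiableAt.hasDerivAt).comp t ht
    rw [h2.deriv]
  rw [integral_add hI1 hIb] at hb
  rw [integral_add hI1 hIv] at hv0
  simp only [mul_sub]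
  rw [integral_sub hIv hIb]
  linarith

end IsContinuityCurve

namespace IsContinuityCurve

variable {T K : ℝ} {b : ℝ → ℝ → ℝ} {r : ℝ → Measure ℝ}

/-- Quantiles are characteristics: almost every quantile moves, at almost every time, with the
velocity field. -/
theorem ae_hasDerivAt_quantile (h : IsContinuityCurve T K b r) (hT : 0 ≤ T) :
    ∀ᵐ s ∂unif, ∀ᵐ t ∂(volume.restrict (Ioo 0 T)),
      HasDerivAt (fun t => quantile (r t) s) (b t (quantile (r t) s)) t := by
  obtain ⟨v, hv, hvK, hvd, S, hS, hSv⟩ := h.exists_particle_velocity hT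
  have hX := h.measurable_quantile_uncurry
  have hbm := h.measurable_velocity
  have hfin : IsFiniteMeasure (volume.restrict (Ioo 0 T)) := ⟨by simp⟩
  set π : Measure (ℝ × ℝ) := (volume.restrict (Ioo 0 T)).prod unif with hπ
  set u : ℝ × ℝ → ℝ := fun p => v p - b p.1 (quantile (r p.1) p.2) with hu
  have hum : Measurable u := hv.sub hbm
  have hub : ∀ p, ‖u p‖ ≤ 2 * K := fun p =>
    (norm_sub_le _ _).trans (by
      have h1 := hvK p
      have h2 := h.bound p.1 (quantile (r p.1) p.2)
      rw [Real.norm_eq_abs, Real.norm_eq_abs]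
      linarith)
  have hK0 : 0 ≤ 2 * K := (norm_nonneg _).trans (hub 0)
  have hzero : ∀ q : ℚ, ∀ᵐ t ∂(volume.restrict (Ioo 0 T)),
      ∫ s in {s | quantile (r t) s ≤ q}, u (t, s) ∂unif = 0 := by
    intro q
    set k : ℝ × ℝ → ℝ := fun p => (Iic (q : ℝ)).indicator 1 (quantile (r p.1) p.2) * u p with hk
    have hkm : Measurable k :=
      ((measurable_one.indicator measurableSet_Iic).comp hX).mul hum
    have hkb : ∀ p, ‖k p‖ ≤ 2 * K := fun p => by
      rw [hk, norm_mul]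
      refine (mul_le_mul (b := 1) ?_ (hub p) (norm_nonneg _) zero_le_one).trans_eq (one_mul _)
      simp only [indicator]
      split_ifs <;> simp
    have hkt : ∀ t, ∫ s in {s | quantile (r t) s ≤ q}, u (t, s) ∂unif = ∫ s, k (t, s) ∂unif := by
      intro t
      rw [← integral_indicator (measurableSet_quantile_le (r t) q)]
      refine integral_congr_ae (Eventually.of_forall fun s => ?_)
      simp [hk, indicator]
    simp only [hkt]
    refine (ae_restrict_iff' measurableSet_Ioo).2 ?_
    have hkk : StronglyMeasurable fun t => ∫ s, k (t, s) ∂unif :=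
      hkm.stronglyMeasurable.integral_prod_right
    have hkkb : ∀ t, ‖∫ s, k (t, s) ∂unif‖ ≤ 2 * K := fun t =>
      (norm_integral_le_of_norm_le_const (Eventually.of_forall fun s => hkb _)).trans (by simp)
    have hloc : LocallyIntegrable (fun t => ∫ s, k (t, s) ∂unif) :=
      (locallyIntegrable_const (2 * K)).mono hkk.aestronglyMeasurable
        (Eventually.of_forall fun t => by
          rw [Real.norm_of_nonneg hK0]; exact hkkb t)
    refine isOpen_Ioo.ae_eq_zero_of_integral_contDiff_smul_eq_zero
      (hloc.locallyIntegrableOn _) fun θ hθ hθc hθs => ?_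
    obtain ⟨A, hA⟩ := hθc.exists_bound_of_continuous hθ.continuous
    have hA0 : 0 ≤ A := (norm_nonneg _).trans (hA 0)
    -- Only `ψ'` enters the identity, so it is `ψ'` that must approach the indicator, boundedly.
    obtain ⟨ψ, hψ, hψc, ⟨C, hC⟩, hψl⟩ := exists_smooth_deriv_approx_Iic (q : ℝ)
    have hC0 : 0 ≤ C := (abs_nonneg _).trans (hC 0 0)
    have h0 : ∀ n, ∫ p, θ p.1 * (deriv (ψ n) (quantile (r p.1) p.2) * u p) ∂π = 0 := fun n =>
      h.integral_test_particle_velocity hT hv hvK hvd hθ hθc hθs (hψ n) (hψc n)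
    have hl : Tendsto (fun n => ∫ p, θ p.1 * (deriv (ψ n) (quantile (r p.1) p.2) * u p) ∂π) atTop
        (𝓝 (∫ p, θ p.1 * k p ∂π)) := by
      refine tendsto_integral_of_dominated_convergence (fun _ => A * (C * (2 * K)))
        (fun n => ?_) (integrable_const _) (fun n => Eventually.of_forall fun p => ?_)
        (Eventually.of_forall fun p => ?_)
      · exact ((hθ.continuous.measurable.comp measurable_fst).mul
          (((measurable_deriv (ψ n)).comp hX).mul hum)).aestronglyMeasurable
      · rw [norm_mul, norm_mul]
        exact mul_le_mul (hA _) (mul_le_mul (hC _ _) (hub _) (norm_nonneg _) hC0) (by positivity) hA0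
      · exact ((hψl _).mul_const _).const_mul _
    simp only [h0] at hl
    have h1 : ∫ p, θ p.1 * k p ∂π = 0 := (tendsto_nhds_unique hl tendsto_const_nhds)
    have hInt : Integrable (fun p : ℝ × ℝ => θ p.1 * k p) π := by
      refine Integrable.of_bound ((hθ.continuous.measurable.comp measurable_fst).mul
        hkm).aestronglyMeasurable (A * (2 * K)) (Eventually.of_forall fun p => ?_)
      rw [norm_mul]
      exact mul_le_mul (hA _) (hkb _) (norm_nonneg _) hA0
    rw [integral_prod _ hInt] at h1
    simp only [integral_const_mul] at h1
    rw [setIntegral_eq_integral_of_forall_compl_eq_zero fun t ht => by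
      rw [image_eq_zero_of_notMem_tsupport fun h' => ht (hθs h'), zero_mul]] at h1
    simpa using h1
  have hall : ∀ᵐ t ∂(volume.restrict (Ioo 0 T)), ∀ᵐ s ∂unif, u (t, s) = 0 := by
    filter_upwards [ae_all_iff.2 hzero, hS] with t h1 h2
    have hi : Integrable (fun s => u (t, s)) unif :=
      Integrable.of_bound (hum.comp measurable_prodMk_left).aestronglyMeasurable (2 * K)
        (Eventually.of_forall fun s => hub _)
    -- On `S` both `v` and `b` depend on `s` only through the position, so their difference is
    -- constant on level sets.
    refine ae_eq_zero_of_setIntegral_quantile_le (S := {s | (t, s) ∈ S}) hi h2 ?_ h1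
    intro s hs s' hs' hs1 hs1' heq
    simp only [hu]
    rw [hSv t s s' hs hs' hs1 hs1' heq, heq]
  have hall' : ∀ᵐ s ∂unif, ∀ᵐ t ∂(volume.restrict (Ioo 0 T)), u (t, s) = 0 :=
    (Measure.ae_ae_comm (p := fun t s => u (t, s) = 0)
      (measurableSet_eq_fun hum measurable_const)).1 hall
  filter_upwards [hall'] with s hs
  filter_upwards [hs, hvd s] with t ht hd
  rwa [← sub_eq_zero.1 ht]

end IsContinuityCurve

/-! ### Contraction estimate for odd one-sided Lipschitz interactions -/

theorem Real.measurable_sign : Measurable Real.sign :=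
  Measurable.ite measurableSet_Iio measurable_const
    (Measurable.ite measurableSet_Ioi measurable_const measurable_const)

theorem Real.abs_sign_le_one (x : ℝ) : |Real.sign x| ≤ 1 := by
  rcases Real.sign_apply_eq x with h | h | h <;> simp [h]

theorem AbsolutelyContinuousOnInterval.abs_sub_abs_eq_integral {f f' : ℝ → ℝ} {a b : ℝ}
    (hab : a ≤ b) (hf : AbsolutelyContinuousOnInterval (fun t => |f t|) a b)
    (hd : ∀ᵐ t ∂(volume.restrict (Ioo a b)), HasDerivAt f (f' t) t) :
    |f b| - |f a| = ∫ t in Ioo a b, Real.sign (f t) * f' t := by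
  rw [← hf.integral_deriv_eq_sub, intervalIntegral.integral_of_le hab, integral_Ioc_eq_integral_Ioo]
  refine integral_congr_ae ?_
  filter_upwards [hd] with t ht
  rcases lt_trichotomy (f t) 0 with h | h | h
  · have h1 := (hasDerivAt_abs_neg h).comp t ht
    rw [Real.sign_of_neg h]
    exact h1.deriv
  -- At a zero of `f` the `deriv` of `|f|` is `0`, by minimality or by the default value, which
  -- matches `Real.sign 0 = 0`.
  · have h1 : IsLocalMin (fun t => |f t|) t := Eventually.of_forall fun y => by
      simp only [h, abs_zero]; exact abs_nonneg _
    rw [h1.deriv_eq_zero, h, Real.sign_zero, zero_mul]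
  · have h1 := (hasDerivAt_abs_pos h).comp t ht
    rw [Real.sign_of_pos h]
    exact h1.deriv

/-- Grönwall's inequality in integral form. -/
theorem le_mul_exp_of_le_add_integral {D : ℝ → ℝ} {T C D₀ : ℝ} (hD : ContinuousOn D (Icc 0 T))
    (hC : 0 ≤ C) (h : ∀ t ∈ Icc 0 T, D t ≤ D₀ + C * ∫ τ in (0 : ℝ)..t, D τ) :
    ∀ t ∈ Icc 0 T, D t ≤ D₀ * Real.exp (C * t) := by
  intro t ht
  -- The right-hand side of the hypothesis, discounted by `exp (-(C * t))`, is nonincreasing and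
  -- starts from `D₀`.
  set Φ : ℝ → ℝ := fun t => Real.exp (-(C * t)) * (D₀ + C * ∫ τ in (0 : ℝ)..t, D τ) with hΦ
  have hint : IntervalIntegrable D volume 0 T :=
    ContinuousOn.intervalIntegrable (by rwa [uIcc_of_le (ht.1.trans ht.2)])
  have hIc : ContinuousOn (fun t => ∫ τ in (0 : ℝ)..t, D τ) (Icc 0 T) := by
    have := (hint.absolutelyContinuousOnInterval_intervalIntegral
      (c := 0) left_mem_uIcc).continuousOn
    rwa [uIcc_of_le (ht.1.trans ht.2)] at this
  have hd : ∀ x ∈ Ioo 0 T, HasDerivAt Φ (Real.exp (-(C * x)) * -C *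
      (D₀ + C * ∫ τ in (0 : ℝ)..x, D τ) + Real.exp (-(C * x)) * (C * D x)) x := by
    intro x hx
    have h1 : HasDerivAt (fun t => ∫ τ in (0 : ℝ)..t, D τ) (D x) x :=
      intervalIntegral.integral_hasDerivAt_right
        (hint.mono_set (by
          rw [uIcc_of_le hx.1.le, uIcc_of_le (ht.1.trans ht.2)]; exact Icc_subset_Icc_right hx.2.le))
        ((hD.mono Ioo_subset_Icc_self).stronglyMeasurableAtFilter isOpen_Ioo x hx)
        (hD.continuousAt (Icc_mem_nhds hx.1 hx.2))
    have h2 : HasDerivAt (fun t => Real.exp (-(C * t))) (Real.exp (-(C * x)) * -C) x := by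
      have := ((hasDerivAt_id x).const_mul C).neg.exp
      simpa using this
    exact h2.mul ((h1.const_mul C).const_add D₀)
  have hanti : AntitoneOn Φ (Icc 0 T) := by
    refine antitoneOn_of_deriv_nonpos (convex_Icc 0 T) ?_ ?_ ?_
    · exact (Continuous.continuousOn (by fun_prop)).mul
        (continuousOn_const.add (continuousOn_const.mul hIc))
    · rw [interior_Icc]
      exact fun x hx => (hd x hx).differentiableAt.differentiableWithinAt
    · rw [interior_Icc]
      intro x hx
      rw [(hd x hx).deriv]
      have h1 := mul_nonneg (mul_nonneg (Real.exp_pos (-(C * x))).le hC)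
        (sub_nonneg.2 (h x (Ioo_subset_Icc_self hx)))
      linarith
  have h1 : Φ t ≤ D₀ := by
    have := hanti (left_mem_Icc.2 (ht.1.trans ht.2)) ht ht.1
    simpa [hΦ] using this
  refine (h t ht).trans ?_
  have h2 := mul_le_mul_of_nonneg_right h1 (Real.exp_pos (C * t)).le
  have h3 : Φ t * Real.exp (C * t) = D₀ + C * ∫ τ in (0 : ℝ)..t, D τ := by
    simp only [hΦ]
    rw [mul_right_comm, ← Real.exp_add, neg_add_cancel, Real.exp_zero, one_mul]
  rwa [h3] at h2

/-- The one-sided Lipschitz condition, tested against signs. -/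
theorem sign_sub_sign_mul_le {lam : ℝ} {w : ℝ → ℝ} (hlam : 0 ≤ lam)
    (hw : Antitone fun x => w x - lam * x) (p q z z' : ℝ) (hpq : p - q = z - z') :
    (Real.sign z - Real.sign z') * (w p - w q) ≤ 2 * lam * (|z| + |z'|) := by
  have h1 : q ≤ p → w p - w q ≤ lam * (z - z') := fun h => by
    have := hw h
    simp only at this
    rw [← hpq]; linarith
  have h2 : p ≤ q → w q - w p ≤ lam * (z' - z) := fun h => by
    have := hw h
    simp only at this
    rw [← neg_sub z z', ← hpq]; linarith
  have h3 : lam * (z - z') ≤ lam * (|z| + |z'|) :=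
    mul_le_mul_of_nonneg_left (by linarith [le_abs_self z, neg_abs_le z']) hlam
  have h4 : lam * (z' - z) ≤ lam * (|z| + |z'|) :=
    mul_le_mul_of_nonneg_left (by linarith [le_abs_self z', neg_abs_le z]) hlam
  have h5 : 0 ≤ lam * (|z| + |z'|) := by positivity
  have e1 : z = 0 → Real.sign z = 0 := fun h => by rw [h, Real.sign_zero]
  have e2 : z' = 0 → Real.sign z' = 0 := fun h => by rw [h, Real.sign_zero]
  -- When the signs differ, they also fix the order of `p` and `q`, in the direction where the
  -- one-sided condition is useful. The factor `2` is the largest jump of the sign.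
  rcases lt_trichotomy z 0 with hz | hz | hz <;> rcases lt_trichotomy z' 0 with hz' | hz' | hz'
  · rw [Real.sign_of_neg hz, Real.sign_of_neg hz']; linarith
  · have := h2 (by linarith)
    rw [Real.sign_of_neg hz, e2 hz']; linarith
  · have := h2 (by linarith)
    rw [Real.sign_of_neg hz, Real.sign_of_pos hz']; linarith
  · have := h1 (by linarith)
    rw [Real.sign_of_neg hz', e1 hz]; linarith
  · rw [hz, hz']; simp
  · have := h2 (by linarith)
    rw [Real.sign_of_pos hz', e1 hz]; linarith
  · have := h1 (by linarith)
    rw [Real.sign_of_pos hz, Real.sign_of_neg hz']; linarith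
  · have := h1 (by linarith)
    rw [Real.sign_of_pos hz, e2 hz']; linarith
  · rw [Real.sign_of_pos hz, Real.sign_of_pos hz']; linarith

/-- Interaction through an odd, one-sided Lipschitz kernel separates two configurations at most
at rate `2 * lam` in `L¹`. -/
theorem integral_sign_mul_interaction_le {Ω : Type*} [MeasurableSpace Ω] {P : Measure Ω}
    [IsProbabilityMeasure P] {lam K : ℝ} {w : ℝ → ℝ} (hlam : 0 ≤ lam)
    (hw : Antitone fun x => w x - lam * x) (hwm : Measurable w) (hodd : ∀ x, w (-x) = -w x)
    (hwK : ∀ x, |w x| ≤ K) {x y : Ω → ℝ} (hx : Measurable x) (hy : Measurable y)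
    (hxy : Integrable (fun s => x s - y s) P) :
    ∫ s, Real.sign (x s - y s) * ((∫ s', w (x s - x s') ∂P) - ∫ s', w (y s - y s') ∂P) ∂P
      ≤ 2 * lam * ∫ s, |x s - y s| ∂P := by
  set d : Ω × Ω → ℝ := fun p => w (x p.1 - x p.2) - w (y p.1 - y p.2) with hd
  have hdm : Measurable d := by
    refine (hwm.comp ?_).sub (hwm.comp ?_) <;> fun_prop
  have hdK : ∀ p, ‖d p‖ ≤ 2 * K := fun p => by
    refine (norm_sub_le _ _).trans ?_
    have h1 := hwK (x p.1 - x p.2)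
    have h2 := hwK (y p.1 - y p.2)
    rw [Real.norm_eq_abs, Real.norm_eq_abs]
    linarith
  have hσ : Measurable fun s => Real.sign (x s - y s) := Real.measurable_sign.comp (hx.sub hy)
  have hσd : ∀ g : Ω × Ω → Ω, Measurable g →
      Integrable (fun p => Real.sign (x (g p) - y (g p)) * d p) (P.prod P) := by
    intro g hg
    refine Integrable.of_bound ((hσ.comp hg).mul hdm).aestronglyMeasurable (1 * (2 * K))
      (Eventually.of_forall fun p => ?_)
    rw [norm_mul]
    exact mul_le_mul (Real.abs_sign_le_one _) (hdK p) (norm_nonneg _) zero_le_one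
  have hwi : ∀ (f : Ω → ℝ) (a : ℝ), Measurable f → Integrable (fun s' => w (a - f s')) P :=
    fun f a hf => Integrable.of_bound
      (hwm.comp (measurable_const.sub hf)).aestronglyMeasurable K
      (Eventually.of_forall fun s => hwK _)
  have hI : ∫ s, Real.sign (x s - y s) *
      ((∫ s', w (x s - x s') ∂P) - ∫ s', w (y s - y s') ∂P) ∂P
      = ∫ p, Real.sign (x p.1 - y p.1) * d p ∂(P.prod P) := by
    rw [integral_prod _ (hσd Prod.fst measurable_fst)]
    refine integral_congr_ae (Eventually.of_forall fun s => ?_)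
    simp only [hd]
    rw [integral_const_mul, integral_sub (hwi x _ hx) (hwi y _ hy)]
  -- Oddness of `w` is action-reaction: exchanging the particles flips `d`, so twice the integral is
  -- the one with `sign (x s - y s) - sign (x s' - y s')`.
  have hanti : ∀ p : Ω × Ω, d p.swap = -d p := fun p => by
    simp only [hd, Prod.fst_swap, Prod.snd_swap]
    rw [← neg_sub (x p.1), ← neg_sub (y p.1), hodd, hodd]
    ring
  have hI' : ∫ p, Real.sign (x p.1 - y p.1) * d p ∂(P.prod P)
      = -∫ p, Real.sign (x p.2 - y p.2) * d p ∂(P.prod P) := by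
    rw [← integral_prod_swap, ← integral_neg]
    refine integral_congr_ae (Eventually.of_forall fun p => ?_)
    simp only [hanti, Prod.fst_swap, mul_neg]
  have hZ1 : Integrable (fun p : Ω × Ω => |x p.1 - y p.1|) (P.prod P) := hxy.abs.comp_fst P
  have hZ2 : Integrable (fun p : Ω × Ω => |x p.2 - y p.2|) (P.prod P) := hxy.abs.comp_snd P
  have h1 : ∫ p, (Real.sign (x p.1 - y p.1) * d p - Real.sign (x p.2 - y p.2) * d p) ∂(P.prod P)
      ≤ ∫ p, 2 * lam * (|x p.1 - y p.1| + |x p.2 - y p.2|) ∂(P.prod P) := by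
    refine integral_mono ((hσd Prod.fst measurable_fst).sub (hσd Prod.snd measurable_snd))
      ((hZ1.add hZ2).const_mul _) fun p => ?_
    beta_reduce
    rw [← sub_mul]
    exact sign_sub_sign_mul_le hlam hw _ _ _ _ (by ring)
  rw [integral_sub (hσd Prod.fst measurable_fst) (hσd Prod.snd measurable_snd),
    integral_const_mul, integral_add hZ1 hZ2, integral_fun_fst (fun s => |x s - y s|),
    integral_fun_snd (fun s => |x s - y s|)] at h1
  simp only [probReal_univ, one_smul] at h1
  rw [hI]
  linarith

namespace IsContinuityCurve

variable {T K : ℝ} {r₁ r₂ : ℝ → Measure ℝ}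

/-- The identity for `|Z|` holds for almost every `s`; Fubini turns it into one for the `L¹`
distance, the interaction estimate bounds the rate, and Grönwall closes. -/
theorem integral_abs_quantile_sub_le {lam : ℝ} {w : ℝ → ℝ} (hlam : 0 ≤ lam)
    (hw : Antitone fun x => w x - lam * x) (hwm : Measurable w) (hodd : ∀ x, w (-x) = -w x)
    (hwK : ∀ x, |w x| ≤ K)
    (h₁ : IsContinuityCurve T K (fun t x => ∫ y, w (x - y) ∂(r₁ t)) r₁)
    (h₂ : IsContinuityCurve T K (fun t x => ∫ y, w (x - y) ∂(r₂ t)) r₂)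
    (hp₁ : ∀ t, IsP1 (r₁ t)) (hp₂ : ∀ t, IsP1 (r₂ t)) :
    ∀ t ∈ Icc 0 T, ∫ s, |quantile (r₁ t) s - quantile (r₂ t) s| ∂unif
      ≤ (∫ s, |quantile (r₁ 0) s - quantile (r₂ 0) s| ∂unif) * Real.exp (2 * lam * t) := by
  intro t₀ ht₀
  have hT : 0 ≤ T := ht₀.1.trans ht₀.2
  have hK := h₁.bound_nonneg
  set Z : ℝ → ℝ → ℝ := fun t s => quantile (r₁ t) s - quantile (r₂ t) s with hZ
  have hZm : Measurable fun p : ℝ × ℝ => Z p.1 p.2 :=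
    h₁.measurable_quantile_uncurry.sub h₂.measurable_quantile_uncurry
  have hZi : ∀ t, Integrable (fun s => Z t s) unif := fun t =>
    (integrable_quantile (hp₁ t)).sub (integrable_quantile (hp₂ t))
  have hZl : ∀ s, ∀ t ∈ Icc 0 T, ∀ t' ∈ Icc 0 T, |(|Z t s| - |Z t' s|)| ≤ 2 * K * |t - t'| := by
    intro s t ht t' ht'
    refine (abs_abs_sub_abs_le _ _).trans ?_
    have e1 := h₁.abs_quantile_sub_le s ht ht'
    have e2 := h₂.abs_quantile_sub_le s ht ht'
    have e3 : Z t s - Z t' s = (quantile (r₁ t) s - quantile (r₁ t') s) -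
        (quantile (r₂ t) s - quantile (r₂ t') s) := by simp only [hZ]; ring
    rw [e3]
    exact (abs_sub _ _).trans (by linarith)
  set D : ℝ → ℝ := fun t => ∫ s, |Z t s| ∂unif with hD
  have hDc : ContinuousOn D (Icc 0 T) := by
    refine LipschitzOnWith.continuousOn (K := (2 * K).toNNReal)
      (LipschitzOnWith.of_dist_le_mul fun t ht t' ht' => ?_)
    rw [Real.coe_toNNReal _ (by positivity), Real.dist_eq, Real.dist_eq,
      ← integral_sub (hZi t).abs (hZi t').abs]
    exact (norm_integral_le_of_norm_le_const (f := fun s => |Z t s| - |Z t' s|)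
      (Eventually.of_forall fun s => hZl s t ht t' ht')).trans (by simp)
  set B : ℝ × ℝ → ℝ := fun p => (∫ y, w (quantile (r₁ p.1) p.2 - y) ∂(r₁ p.1)) -
    ∫ y, w (quantile (r₂ p.1) p.2 - y) ∂(r₂ p.1) with hB
  have hBm : Measurable B := h₁.measurable_velocity.sub h₂.measurable_velocity
  have hBK : ∀ p, ‖B p‖ ≤ 2 * K := fun p => by
    refine (norm_sub_le _ _).trans ?_
    have e1 := h₁.bound p.1 (quantile (r₁ p.1) p.2)
    have e2 := h₂.bound p.1 (quantile (r₂ p.1) p.2)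
    rw [Real.norm_eq_abs, Real.norm_eq_abs]
    linarith
  set F : ℝ × ℝ → ℝ := fun p => Real.sign (Z p.1 p.2) * B p with hF
  have hFm : Measurable F := (Real.measurable_sign.comp hZm).mul hBm
  have hFK : ∀ p, ‖F p‖ ≤ 1 * (2 * K) := fun p => by
    rw [hF, norm_mul]
    exact mul_le_mul (Real.abs_sign_le_one _) (hBK p) (norm_nonneg _) zero_le_one
  have hrate : ∀ t, ∫ s, F (t, s) ∂unif ≤ 2 * lam * D t := by
    intro t
    have := h₁.prob t
    have := h₂.prob t
    have e : ∀ (μ : Measure ℝ) [IsProbabilityMeasure μ] (x : ℝ),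
        ∫ y, w (x - y) ∂μ = ∫ s', w (x - quantile μ s') ∂unif := fun μ _ x =>
      integral_quantile μ (hwm.comp (measurable_const.sub measurable_id))
    simp only [hF, hB, e]
    exact integral_sign_mul_interaction_le hlam hw hwm hodd hwK (measurable_quantile (r₁ t))
      (measurable_quantile (r₂ t)) (hZi t)
  refine le_mul_exp_of_le_add_integral hDc (by positivity) (fun t ht => ?_) t₀ ht₀
  have hfin : IsFiniteMeasure (volume.restrict (Ioo 0 t)) := ⟨by simp⟩
  have hsub : Ioo 0 t ⊆ Ioo 0 T := Ioo_subset_Ioo_right ht.2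
  have hFi : Integrable F ((volume.restrict (Ioo 0 t)).prod unif) :=
    Integrable.of_bound hFm.aestronglyMeasurable _ (Eventually.of_forall hFK)
  have hpath : ∀ᵐ s ∂unif, |Z t s| - |Z 0 s| = ∫ τ in Ioo 0 t, F (τ, s) := by
    filter_upwards [h₁.ae_hasDerivAt_quantile hT, h₂.ae_hasDerivAt_quantile hT] with s hs₁ hs₂
    have hac : AbsolutelyContinuousOnInterval (fun τ => |Z τ s|) 0 t := by
      refine LipschitzOnWith.absolutelyContinuousOnInterval (K := (2 * K).toNNReal)
        (LipschitzOnWith.of_dist_le_mul fun τ hτ τ' hτ' => ?_)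
      rw [uIcc_of_le ht.1] at hτ hτ'
      rw [Real.coe_toNNReal _ (by positivity), Real.dist_eq, Real.dist_eq]
      exact hZl s τ ⟨hτ.1, hτ.2.trans ht.2⟩ τ' ⟨hτ'.1, hτ'.2.trans ht.2⟩
    refine hac.abs_sub_abs_eq_integral (f := fun τ => Z τ s) (f' := fun τ => B (τ, s)) ht.1 ?_
    filter_upwards [ae_restrict_of_ae_restrict_of_subset hsub hs₁,
      ae_restrict_of_ae_restrict_of_subset hsub hs₂] with τ hτ₁ hτ₂
    exact hτ₁.sub hτ₂
  have h3 : D t - D 0 = ∫ τ in Ioo 0 t, ∫ s, F (τ, s) ∂unif := by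
    simp only [hD]
    rw [← integral_sub (hZi t).abs (hZi 0).abs, integral_congr_ae hpath,
      ← integral_prod _ hFi, integral_prod_symm _ hFi]
  have h4 : ∫ τ in Ioo 0 t, ∫ s, F (τ, s) ∂unif ≤ ∫ τ in Ioo 0 t, 2 * lam * D τ := by
    refine integral_mono hFi.integral_prod_left ?_ hrate
    have : IntegrableOn (fun τ => 2 * lam * D τ) (Icc 0 t) :=
      ((continuousOn_const.mul hDc).mono (Icc_subset_Icc_right ht.2)).integrableOn_Icc
    exact this.mono_set Ioo_subset_Icc_self
  have h5 : ∫ τ in (0 : ℝ)..t, D τ = ∫ τ in Ioo 0 t, D τ := by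
    rw [intervalIntegral.integral_of_le ht.1, integral_Ioc_eq_integral_Ioo]
  rw [integral_const_mul, ← h5] at h4
  change D t ≤ D 0 + _
  linarith

end IsContinuityCurve

/-! ### Pointy potentials and reduction to continuity curves -/

theorem LipschitzWith.abs_le_of_hasDerivWithinAt {f : ℝ → ℝ} {K : ℝ≥0} (hf : LipschitzWith K f)
    {s : Set ℝ} {x f' : ℝ} (hx : x ∉ s) [(𝓝[s] x).NeBot] (hd : HasDerivWithinAt f f' s x) :
    |f'| ≤ K := by
  refine le_of_tendsto ((hasDerivWithinAt_iff_tendsto_slope' hx).1 hd).abs ?_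
  filter_upwards [self_mem_nhdsWithin] with y hy
  have hne : y - x ≠ 0 := sub_ne_zero.2 fun h => hx (h ▸ hy)
  have h1 := hf.dist_le_mul y x
  rw [Real.dist_eq, Real.dist_eq] at h1
  rw [slope_def_field, abs_div, div_le_iff₀ (abs_pos.2 hne)]
  exact h1

/-- The derivative of a pointy potential, normalised to vanish at the origin. -/
noncomputable def centeredDeriv (W' : ℝ → ℝ) (x : ℝ) : ℝ := if x = 0 then 0 else W' x

section PointyPotential

variable {lam : ℝ} {W W' : ℝ → ℝ}

theorem IsPointyPotential.differentiableWithinAt (hW : IsPointyPotential lam W) (x : ℝ) :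
    DifferentiableWithinAt ℝ W (Ioi x) x ∧ DifferentiableWithinAt ℝ W (Iio x) x := by
  have hc := hW.concave.neg
  have hx : x ∈ interior (univ : Set ℝ) := by simp
  have h1 := (hc.differentiableWithinAt_Ioi_of_mem_interior hx).neg
  have h2 := (hc.differentiableWithinAt_Iio_of_mem_interior hx).neg
  have hq : ∀ s : Set ℝ, DifferentiableWithinAt ℝ (fun x : ℝ => lam / 2 * x ^ 2) s x := fun s =>
    Differentiable.differentiableAt (by fun_prop) |>.differentiableWithinAt
  have e : W = fun x => (- -fun x => W x - lam / 2 * x ^ 2) x + lam / 2 * x ^ 2 := by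
    funext x; simp
  rw [e]
  exact ⟨h1.add (hq _), h2.add (hq _)⟩

/-- Both sides are one-sided derivatives of a concave function, separated by the slope of the chord
from `x` to `y`. -/
theorem IsPointyPotential.sub_le_sub (hW : IsPointyPotential lam W) {x y : ℝ} (hxy : x < y) :
    derivWithin W (Iio y) y - lam * y ≤ derivWithin W (Ioi x) x - lam * x := by
  have hq : ∀ (z : ℝ) (s : Set ℝ), HasDerivWithinAt (fun x : ℝ => lam / 2 * x ^ 2) (lam * z) s z :=
    fun z s => by
      have h := ((hasDerivAt_pow 2 z).const_mul (lam / 2)).hasDerivWithinAt (s := s)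
      exact h.congr_deriv (by push_cast; ring)
  have h1 := hW.concave.slope_le_of_hasDerivWithinAt_Ioi (mem_univ x) (mem_univ y) hxy
    ((hW.differentiableWithinAt x).1.hasDerivWithinAt.sub (hq x _))
  have h2 := hW.concave.le_slope_of_hasDerivWithinAt_Iio (mem_univ x) (mem_univ y) hxy
    ((hW.differentiableWithinAt y).2.hasDerivWithinAt.sub (hq y _))
  exact h2.trans h1

theorem centeredDeriv_neg (hW' : IsPointyDeriv W W') (x : ℝ) :
    centeredDeriv W' (-x) = -centeredDeriv W' x := by
  by_cases hx : x = 0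
  · simp [centeredDeriv, hx]
  · simp [centeredDeriv, hx, hW'.odd x hx]

theorem antitone_centeredDeriv (hW : IsPointyPotential lam W) (hW' : IsPointyDeriv W W') :
    Antitone fun x => centeredDeriv W' x - lam * x := by
  have key : ∀ x y : ℝ, x ≠ 0 → y ≠ 0 → x < y →
      centeredDeriv W' y - lam * y ≤ centeredDeriv W' x - lam * x := by
    intro x y hx hy hxy
    have h1 := hW.sub_le_sub hxy
    have h2 := (hW'.mem x hx).1
    have h3 := (hW'.mem y hy).2
    simp only [centeredDeriv, hx, hy, if_false]
    linarith
  have h0 : centeredDeriv W' 0 = 0 := by simp [centeredDeriv]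
  intro x y hxy
  rcases hxy.eq_or_lt with rfl | hlt
  · exact le_rfl
  beta_reduce
  rcases eq_or_ne x 0 with hx | hx
  · subst hx
    -- Comparing `-y` with `y`, oddness gives `2 * w y ≤ 2 * lam * y`: the value `0` at the origin
    -- is consistent with monotonicity.
    have h1 := key (-y) y (neg_lt_zero.2 hlt |>.ne) hlt.ne' (by linarith)
    rw [centeredDeriv_neg hW'] at h1
    rw [h0]
    linarith
  rcases eq_or_ne y 0 with hy | hy
  · subst hy
    have h1 := key x (-x) hlt.ne (neg_ne_zero.2 hlt.ne) (by linarith)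
    rw [centeredDeriv_neg hW'] at h1
    rw [h0]
    linarith
  exact key x y hx hy hlt

/-- Whatever values are chosen at the corners, the kernel is a monotone function plus a linear one.
-/
theorem measurable_centeredDeriv (hW : IsPointyPotential lam W) (hW' : IsPointyDeriv W W') :
    Measurable (centeredDeriv W') := by
  have e : centeredDeriv W' = fun x => (centeredDeriv W' x - lam * x) + lam * x := by
    funext x; ring
  rw [e]
  exact (antitone_centeredDeriv hW hW').measurable.add (measurable_id.const_mul lam)

theorem exists_abs_centeredDeriv_le (hW : IsPointyPotential lam W) (hW' : IsPointyDeriv W W') :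
    ∃ K : ℝ, ∀ x, |centeredDeriv W' x| ≤ K := by
  obtain ⟨K, hK⟩ := hW.lipschitz
  refine ⟨K, fun x => ?_⟩
  by_cases hx : x = 0
  · simp [centeredDeriv, hx]
  have h1 := hW.differentiableWithinAt x
  have h2 := abs_le.1 (hK.abs_le_of_hasDerivWithinAt (by simp) h1.1.hasDerivWithinAt)
  have h3 := abs_le.1 (hK.abs_le_of_hasDerivWithinAt (by simp) h1.2.hasDerivWithinAt)
  have h4 := hW'.mem x hx
  simp only [centeredDeriv, hx, if_false]
  exact abs_le.2 ⟨h2.1.trans h4.1, h4.2.trans h3.2⟩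

/-- Leaving out `y = x` amounts to giving the kernel the value `0` at the origin, the value
compatible with oddness. -/
theorem macroVelocity_eq_integral (W' : ℝ → ℝ) (μ : Measure ℝ) (x : ℝ) :
    macroVelocity W' μ x = ∫ y, centeredDeriv W' (x - y) ∂μ := by
  have h : ∀ y, y ∉ ({x}ᶜ : Set ℝ) → centeredDeriv W' (x - y) = 0 := fun y hy => by
    have : y = x := by simpa using hy
    simp [this, centeredDeriv]
  rw [macroVelocity, ← setIntegral_eq_integral_of_forall_compl_eq_zero h]
  refine setIntegral_congr_fun (measurableSet_singleton x).compl fun y hy => ?_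
  have : x - y ≠ 0 := sub_ne_zero.2 fun h => hy h.symm
  simp [centeredDeriv, this]

end PointyPotential

theorem measurableSet_openTime (T : ℝ≥0∞) : MeasurableSet (openTime T) :=
  measurableSet_Ioi.inter (measurableSet_lt ENNReal.measurable_ofReal measurable_const)

/-- A solution of the aggregation equation, stopped at time `τ`, is a continuity curve. -/
theorem IsAggregationSolution.isContinuityCurve {lam : ℝ} {W W' : ℝ → ℝ} {T : ℝ≥0∞}
    {ρini : Measure ℝ} {ρ : ℝ → Measure ℝ} (hW : IsPointyPotential lam W)
    (hW' : IsPointyDeriv W W') (h : IsAggregationSolution T W' ρini ρ) {K : ℝ}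
    (hK : ∀ x, |centeredDeriv W' x| ≤ K) {τ : ℝ} (hτ : τ ∈ closedTime T) :
    IsContinuityCurve τ K
      (fun t x => ∫ y, centeredDeriv W' (x - y) ∂(ρ (max 0 (min t τ))))
      (fun t => ρ (max 0 (min t τ))) := by
  have hmem : ∀ t, max 0 (min t τ) ∈ closedTime T := fun t =>
    ⟨le_max_left _ _, (ENNReal.ofReal_le_ofReal (max_le hτ.1 (min_le_right _ _))).trans hτ.2⟩
  have hprob : ∀ t, IsProbabilityMeasure (ρ (max 0 (min t τ))) := fun t => (h.memP1 _ (hmem t)).1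
  have hcont : ∀ f : ℝ → ℝ, Continuous f → HasCompactSupport f →
      Continuous fun t => ∫ x, f x ∂(ρ (max 0 (min t τ))) := by
    intro f hf hfc
    exact (h.continuous ⟨⟨f, hf⟩, hfc.is_zero_at_infty⟩).comp_continuous (by fun_prop) hmem
  have hwm := measurable_centeredDeriv hW hW'
  refine ⟨hprob, hcont, ?_, fun t x => ?_, fun φ hφ hφc hφs => ?_⟩
  · have hX := measurable_quantile_uncurry (measurable_cdf_of_continuous hprob hcont)
    -- Quantiles turn integration against a moving measure into integration over the fixed `unif`,
    -- where parameter integrals are measurable.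
    have e : (Function.uncurry fun t x => ∫ y, centeredDeriv W' (x - y) ∂(ρ (max 0 (min t τ)))) =
        fun p : ℝ × ℝ => ∫ s, centeredDeriv W' (p.2 - quantile (ρ (max 0 (min p.1 τ))) s) ∂unif := by
      funext p
      have := hprob p.1
      exact integral_quantile _ (hwm.comp (measurable_const.sub measurable_id))
    rw [e]
    have hm : Measurable fun q : (ℝ × ℝ) × ℝ =>
        centeredDeriv W' (q.1.2 - quantile (ρ (max 0 (min q.1.1 τ))) q.2) :=
      hwm.comp ((measurable_snd.comp measurable_fst).sub
        (hX.comp ((measurable_fst.comp measurable_fst).prodMk measurable_snd)))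
    exact hm.stronglyMeasurable.integral_prod_right.measurable
  · have := hprob t
    exact (norm_integral_le_of_norm_le_const (f := fun y => centeredDeriv W' (x - y))
      (Eventually.of_forall fun y => hK _)).trans (by simp)
  · have hsub : Ioo 0 τ ⊆ openTime T := fun t ht =>
      ⟨ht.1, ((ENNReal.ofReal_lt_ofReal_iff (ht.1.trans ht.2)).2 ht.2).trans_le hτ.2⟩
    have h1 := h.equation φ hφ hφc (hφs.trans (prod_mono_left hsub))
    -- The equation integrates over all of `openTime T`, but the test function is supported before
    -- `τ`, so later times contribute nothing.
    have h2 : ∀ t ∈ openTime T \ Ioo 0 τ, ∫ x, (deriv (fun s => φ (s, x)) t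
        + macroVelocity W' (ρ t) x * deriv (fun y => φ (t, y)) x) ∂(ρ t) = 0 := by
      intro t ht
      have hz : ∀ x, (t, x) ∉ tsupport φ := fun x hx => ht.2 (hφs hx).1
      have e1 : ∀ x, deriv (fun s => φ (s, x)) t = 0 := fun x => by
        have : (fun s => φ (s, x)) =ᶠ[𝓝 t] fun _ => 0 := by
          have hc : Tendsto (fun s => (s, x)) (𝓝 t) (𝓝 (t, x)) :=
            (Continuous.tendsto (by fun_prop) t)
          exact hc.eventually (notMem_tsupport_iff_eventuallyEq.1 (hz x))
        rw [this.deriv_eq, deriv_const]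
      have e2 : ∀ x, deriv (fun y => φ (t, y)) x = 0 := fun x => by
        have : (fun y => φ (t, y)) = fun _ => 0 :=
          funext fun y => image_eq_zero_of_notMem_tsupport (hz y)
        rw [this, deriv_const]
      simp [e1, e2]
    rw [setIntegral_eq_of_subset_of_forall_sdiff_eq_zero (measurableSet_openTime T) hsub h2] at h1
    refine Eq.trans (setIntegral_congr_fun measurableSet_Ioo fun t ht => ?_) h1
    have ht' : max 0 (min t τ) = t := by rw [min_eq_left ht.2.le, max_eq_right ht.1.le]
    simp only [ht', macroVelocity_eq_integral]

/-! ### Stability and uniqueness -/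

theorem mainTheorem4 (lam : ℝ) (W W' : ℝ → ℝ) (hW : IsPointyPotential lam W)
    (hW' : IsPointyDeriv W W') (T : ℝ≥0∞) (ρ₁ini ρ₂ini : Measure ℝ) (ρ₁ ρ₂ : ℝ → Measure ℝ)
    (h₁ : IsAggregationSolution T W' ρ₁ini ρ₁) (h₂ : IsAggregationSolution T W' ρ₂ini ρ₂) :
    (∀ t ∈ closedTime T, wasserstein1 (ρ₁ t) (ρ₂ t)
      ≤ ENNReal.ofReal (Real.exp (2 * lam * t)) * wasserstein1 ρ₁ini ρ₂ini) ∧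
    (ρ₁ini = ρ₂ini → ∀ t ∈ closedTime T, ρ₁ t = ρ₂ t) := by
  obtain ⟨K, hK⟩ := exists_abs_centeredDeriv_le hW hW'
  have h0 : (0 : ℝ) ∈ closedTime T := ⟨le_rfl, by simp⟩
  have hP₁ := fun t ht => (h₁.memP1 t ht).1
  have hP₂ := fun t ht => (h₂.memP1 t ht).1
  have hint : ∀ t ∈ closedTime T,
      Integrable (fun s => quantile (ρ₁ t) s - quantile (ρ₂ t) s) unif := fun t ht =>
    (integrable_quantile (h₁.memP1 t ht)).sub (integrable_quantile (h₂.memP1 t ht))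
  have main : ∀ t ∈ closedTime T, ∫ s, |quantile (ρ₁ t) s - quantile (ρ₂ t) s| ∂unif ≤
      (∫ s, |quantile ρ₁ini s - quantile ρ₂ini s| ∂unif) * Real.exp (2 * lam * t) := by
    intro t ht
    have hmem : ∀ s, max 0 (min s t) ∈ closedTime T := fun s =>
      ⟨le_max_left _ _, (ENNReal.ofReal_le_ofReal (max_le ht.1 (min_le_right _ _))).trans ht.2⟩
    -- Both solutions are stopped at the very time `t` under study, so `T = ∞` needs no separate
    -- treatment.
    have h := IsContinuityCurve.integral_abs_quantile_sub_le hW.lam_nonneg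
      (antitone_centeredDeriv hW hW') (measurable_centeredDeriv hW hW') (centeredDeriv_neg hW') hK
      (h₁.isContinuityCurve hW hW' hK ht) (h₂.isContinuityCurve hW hW' hK ht)
      (fun s => h₁.memP1 _ (hmem s)) (fun s => h₂.memP1 _ (hmem s)) t ⟨ht.1, le_rfl⟩
    rw [← h₁.initial, ← h₂.initial]
    simpa [ht.1] using h
  have hedist : ∀ μ ν : Measure ℝ, Integrable (fun s => quantile μ s - quantile ν s) unif →
      ∫⁻ s, edist (quantile μ s) (quantile ν s) ∂unif =
        ENNReal.ofReal (∫ s, |quantile μ s - quantile ν s| ∂unif) := by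
    intro μ ν hi
    rw [ofReal_integral_eq_lintegral_ofReal hi.abs (Eventually.of_forall fun s => abs_nonneg _)]
    refine lintegral_congr fun s => ?_
    rw [edist_dist, Real.dist_eq]
  refine ⟨fun t ht => ?_, fun heq t ht => ?_⟩
  · have := hP₁ t ht
    have := hP₂ t ht
    have i₁ : IsProbabilityMeasure ρ₁ini := h₁.initial ▸ hP₁ 0 h0
    have i₂ : IsProbabilityMeasure ρ₂ini := h₂.initial ▸ hP₂ 0 h0
    have hi0 := hint 0 h0
    rw [h₁.initial, h₂.initial] at hi0
    calc wasserstein1 (ρ₁ t) (ρ₂ t)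
        ≤ ∫⁻ s, edist (quantile (ρ₁ t) s) (quantile (ρ₂ t) s) ∂unif :=
          wasserstein1_le_lintegral_quantile _ _
      _ = ENNReal.ofReal (∫ s, |quantile (ρ₁ t) s - quantile (ρ₂ t) s| ∂unif) :=
          hedist _ _ (hint t ht)
      _ ≤ ENNReal.ofReal ((∫ s, |quantile ρ₁ini s - quantile ρ₂ini s| ∂unif) *
            Real.exp (2 * lam * t)) := ENNReal.ofReal_le_ofReal (main t ht)
      _ = ENNReal.ofReal (Real.exp (2 * lam * t)) *
            ∫⁻ s, edist (quantile ρ₁ini s) (quantile ρ₂ini s) ∂unif := by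
          rw [ENNReal.ofReal_mul' (Real.exp_pos _).le, hedist _ _ hi0, mul_comm]
      _ ≤ _ := mul_le_mul_right (lintegral_quantile_le_wasserstein1 _ _) _
  · have := hP₁ t ht
    have := hP₂ t ht
    have h3 := main t ht
    rw [heq] at h3
    simp only [sub_self, abs_zero, integral_zero, zero_mul] at h3
    have h4 := (integral_eq_zero_iff_of_nonneg (fun s => abs_nonneg _) (hint t ht).abs).1
      (le_antisymm h3 (integral_nonneg fun s => abs_nonneg _))
    -- The quantiles agree almost everywhere and transport `unif` to the two measures.
    rw [← map_quantile (ρ₁ t), ← map_quantile (ρ₂ t)]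
    refine Measure.map_congr ?_
    filter_upwards [h4] with s hs
    exact sub_eq_zero.1 (abs_eq_zero.1 hs)
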